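/- **Setting.** Let $\mathbb K$ be a countable set, $-\mathbb K$ a disjoint copy of it, and let $\mathcal V=\mathcal N[\mathbb K\cup-\mathbb K]$ be the algebra freely generated by $\mathbb K\cup-\mathbb K$ under unary operations $u\mapsto u.l$, $u\mapsto u.r$ and a binary operation $\vee$, subject to $(u\vee v).l=u$, $(u\vee v).r=v$, $u.l\vee u.r=u$; for a word $t\in\{l,r\}^*$, $u.t$ denotes the iterated operation. For $V\subseteq\mathcal V$, $\mathcal N[V]$ is the subalgebra generated by $V$. Let $\Sigma$ be a set. A *graph* is a finite set $G\subseteq\Sigma\times\mathcal V$ such that $(\sigma,v),(\sigma',v')\in G$ and $v.t=v'.t'$ imply $\sigma=\sigma'$, $v=v'$, $t=t'$; $V(G)$ is the set of second components of its elements. Let $\mathcal G$ be the set of graphs and $\mathcal H=\ell^2(\mathcal G)$, with canonical orthonormal basis $(|G\rangle)_{G\in\mathcal G}$. Operators are bounded. A *restriction* is a map $\chi:\mathcal G\to\mathcal G$, $G\mapsto G_\chi\subseteq G$, such that $G_\chi\subseteq H\subseteq G$ implies $H_\chi=G_\chi$. Write $G_{\overline\chi}=G\setminus G_\chi$, $G_{\chi\zeta}=(G_\chi)_\zeta$,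 $G_{\chi\cup\zeta}=G_\chi\cup G_\zeta$, and $[\chi,\zeta]=0$ for $\chi\zeta=\zeta\chi$ (also for complements). $\chi$ is *pointwise* if $G_\chi=\bigcup_{s\in G}\{s\}_\chi$ for all $G$. Write $\zeta\sqsubseteq\chi$ if, for all $G,H$, $G_{\chi\zeta}=G_\zeta$ and $\langle H_{\overline\zeta}|G_{\overline\zeta}\rangle=\langle H_{\chi\overline\zeta}|G_{\chi\overline\zeta}\rangle\langle H_{\overline\chi}|G_{\overline\chi}\rangle$. For a trace-class operator $\rho$ on $\mathcal H$, $\rho_{|\chi}=\sum_{G,H}\langle G|\rho|H\rangle\,\langle H_{\overline\chi}|G_{\overline\chi}\rangle\,|G_\chi\rangle\langle H_\chi|$. An operator $U$ on $\mathcal H$ is *$\chi\zeta$-causal* if $(U\rho U^\dagger)_{|\zeta}=(U\rho_{|\chi}U^\dagger)_{|\zeta}$ for all trace-class $\rho$. It is *name-preserving* if $\langle H|U|G\rangle=0$ whenever $\mathcal N[V(G)]\ne\mathcal N[V(H)]$. $\mathcal H_\mu$ is the closed span of the vectors $|G_\mu\rangle$; an operator over $\mathcal H_\mu$ is also regarded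 as an operator on $\mathcal H$ vanishing on $\mathcal H_\mu^\perp$, and it is called $\chi\zeta$-causal over $\mathcal H_\mu$ if the causality equation holds for all trace-class $\rho$ over $\mathcal H_\mu$. Finally $|H\rangle\otimes_\mu|H'\rangle$ is $|G\rangle$ if $H=G_\mu$ and $H'=G_{\overline\mu}$ for some (necessarily unique) $G$, and $0$ if there is no such $G$; and $A\otimes_\mu B$ is the operator $\sum_{G,H,G',H'} \langle G|A|H\rangle\langle G'|B|H'\rangle\,(|G\rangle\otimes_\mu|G'\rangle)(\langle H|\otimes_\mu\langle H'|)$, the sum being taken in the sense of matrix elements. **Proposition.** (i) Let $\chi,\chi',\zeta,\zeta'$ be restrictions with $\chi'\sqsubseteq\chi$ and $\zeta\sqsubseteq\zeta'$. Every $\chi'\zeta'$-causal bounded operator $U$ on $\mathcal H$ is $\chi\zeta$-causal. (ii) Let $\mu,\chi,\zeta$ be restrictions with $\mu$ pointwise and $[\mu,\zeta]=[\overline\mu,\zeta]=[\mu,\overline\zeta]=[\overline\mu,\overline\zeta]=0$. Let $U$ be a unitary operator over $\mathcal H_\mu$ which is name-preserving and $\chi\zeta$-causal over $\mathcal H_\mu$.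 Then $\xi=\mu\chi\cup\overline\mu\zeta$ is a restriction, $U'=U\otimes_\mu I$ is a well-defined bounded operator on $\mathcal H$, it is unitary, and it is $\xi\zeta$-causal. -/

import Mathlib

open scoped InnerProductSpace

namespace QNet

/-! ### The name algebra -/

/-- Directions, the letters of the words `t ∈ {l, r}*`. -/
inductive Dir
  | l
  | r

/-- Terms of the name algebra on a set `X` of generators. The term `u.t`, for a word `t`, is obtained
by iterating the two unary operations `u ↦ u.l` and `u ↦ u.r`. -/
inductive NameTerm (X : Type*)
  | gen (c : X)
  | proj (u : NameTerm X) (d : Dir)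
  | join (u v : NameTerm X)

/-- The equality theory: the least congruence with `(u ∨ v).l = u`, `(u ∨ v).r = v` and
`u.l ∨ u.r = u`. -/
inductive NameTerm.Eqv {X : Type*} : NameTerm X → NameTerm X → Prop
  | refl (u) : Eqv u u
  | symm {u v} : Eqv u v → Eqv v u
  | trans {u v w} : Eqv u v → Eqv v w → Eqv u w
  | proj {u v} (d : Dir) : Eqv u v → Eqv (.proj u d) (.proj v d)
  | join {u u' v v'} : Eqv u u' → Eqv v v' → Eqv (.join u v) (.join u' v')
  | join_l (u v) : Eqv (.proj (.join u v) .l) u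
  | join_r (u v) : Eqv (.proj (.join u v) .r) v
  | split (u) : Eqv (.join (.proj u .l) (.proj u .r)) u

/-- The congruence as a setoid. -/
def nameSetoid (X : Type*) : Setoid (NameTerm X) where
  r := NameTerm.Eqv
  iseqv := ⟨NameTerm.Eqv.refl, NameTerm.Eqv.symm, NameTerm.Eqv.trans⟩

/-- The name algebra `𝒩[X]`. -/
def Name (X : Type*) : Type _ := Quotient (nameSetoid X)

/-- `u.d` for a single letter `d`. -/
def Name.proj {X : Type*} (u : Name X) (d : Dir) : Name X :=
  Quotient.map (sa := nameSetoid X) (sb := nameSetoid X)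
    (fun a => NameTerm.proj a d) (fun _ _ h => NameTerm.Eqv.proj d h) u

/-- `u ∨ v`. -/
def Name.join {X : Type*} (u v : Name X) : Name X :=
  Quotient.map₂ (sa := nameSetoid X) (sb := nameSetoid X) (sc := nameSetoid X)
    NameTerm.join (fun _ _ h _ _ h' => NameTerm.Eqv.join h h') u v

/-- `u.t` for a word `t`; in particular `u.ε = u`. -/
def Name.dot {X : Type*} (u : Name X) (t : List Dir) : Name X :=
  t.foldl Name.proj u

/-- `𝒩[V]` for a set `V` of names: the names built out of those of `V`. -/
inductive Name.Generated {X : Type*} (V : Set (Name X)) : Name X → Prop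
  | base {u} : u ∈ V → Generated V u
  | proj {u} (d : Dir) : Generated V u → Generated V (u.proj d)
  | join {u v} : Generated V u → Generated V v → Generated V (u.join v)

/-- `𝒱 = 𝒩[𝕂 ∪ -𝕂]`; the left summand is `𝕂`, the right one is `-𝕂`. -/
abbrev Vertex (K : Type*) : Type _ := Name (K ⊕ K)

/-- `V ≙ V'`, that is `𝒩[V] = 𝒩[V']`. -/
def SameNames {K : Type*} (V V' : Set (Vertex K)) : Prop :=
  ∀ u, Name.Generated V u ↔ Name.Generated V' u

/-! ### Graphs -/

/-- A graph: a finite set of systems `σ.v` (pairs of an internal state `σ ∈ S` and a vertex `v`)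
which is well-named. -/
@[ext]
structure QGraph (S K : Type*) where
  systems : Finset (S × Vertex K)
  wellNamed : ∀ s ∈ systems, ∀ s' ∈ systems, ∀ t t' : List Dir,
    s.2.dot t = s'.2.dot t' → s = s' ∧ t = t'

namespace QGraph

variable {S K : Type*}

/-- The support `V(G)`. -/
def support (G : QGraph S K) : Set (Vertex K) := {v | ∃ σ : S, (σ, v) ∈ G.systems}

open scoped Classical in
/-- The subgraph of `G` made of its systems that satisfy `p`. -/
noncomputable def sub (G : QGraph S K) (p : S × Vertex K → Prop) : QGraph S K where
  systems := G.systems.filter p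
  wellNamed s hs s' hs' :=
    G.wellNamed s (Finset.mem_of_mem_filter s hs) s' (Finset.mem_of_mem_filter s' hs')

theorem sub_subset (G : QGraph S K) (p : S × Vertex K → Prop) :
    (G.sub p).systems ⊆ G.systems :=
  fun s hs => by
    classical
    exact Finset.mem_of_mem_filter s hs

end QGraph

/-! ### Restrictions -/

/-- A function `χ : 𝒢 → 𝒢`, `G ↦ G_χ`, with `G_χ ⊆ G`. -/
structure Selection (S K : Type*) where
  toFun : QGraph S K → QGraph S K
  subset : ∀ G, (toFun G).systems ⊆ G.systems

namespace Selection

variable {S K : Type*}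

instance : CoeFun (Selection S K) (fun _ => QGraph S K → QGraph S K) := ⟨Selection.toFun⟩

/-- `χ` is a restriction: `G_χ ⊆ H ⊆ G` implies `H_χ = G_χ`. -/
def IsRestriction (χ : Selection S K) : Prop :=
  ∀ G H : QGraph S K, (χ G).systems ⊆ H.systems → H.systems ⊆ G.systems → χ H = χ G

/-- `χ` is pointwise: `G_χ` is the union of the `{s}_χ` over the systems `s ∈ G`
(for `s ∈ G`, the graph `G.sub (· = s)` is `{s}`). -/
def IsPointwise (χ : Selection S K) : Prop :=
  ∀ (G : QGraph S K) (x : S × Vertex K),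
    x ∈ (χ G).systems ↔ ∃ s ∈ G.systems, x ∈ (χ (G.sub (· = s))).systems

/-- The complement: `G_χ̄ = G \ G_χ`. -/
noncomputable def compl (χ : Selection S K) : Selection S K where
  toFun G := G.sub (fun s => s ∉ (χ G).systems)
  subset _ := QGraph.sub_subset _ _

/-- The composite `χζ`: first `χ`, then `ζ`, that is `G_{χζ} = (G_χ)_ζ`. -/
def andThen (χ ζ : Selection S K) : Selection S K where
  toFun G := ζ (χ G)
  subset G := (ζ.subset _).trans (χ.subset G)

/-- The union: `G_{χ ∪ ζ} = G_χ ∪ G_ζ` (both are contained in `G`). -/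
noncomputable def union (χ ζ : Selection S K) : Selection S K where
  toFun G := G.sub (fun s => s ∈ (χ G).systems ∨ s ∈ (ζ G).systems)
  subset _ := QGraph.sub_subset _ _

/-- `[χ, ζ] = 0`, that is `χζ = ζχ`. -/
def Commutes (χ ζ : Selection S K) : Prop := ∀ G, χ.andThen ζ G = ζ.andThen χ G

end Selection

/-! ### The Hilbert space of graphs -/

/-- The Hilbert space `ℋ` whose canonical orthonormal basis is labelled by the graphs. -/
abbrev Hilb (S K : Type*) : Type _ := lp (fun _ : QGraph S K => ℂ) 2

/-- Bounded operators on `ℋ`. -/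
abbrev Op (S K : Type*) : Type _ := Hilb S K →L[ℂ] Hilb S K

section Operators

variable {S K : Type*}

open scoped Classical in
/-- The basis vector `|G⟩`. -/
noncomputable def ket (G : QGraph S K) : Hilb S K := lp.single 2 G (1 : ℂ)

/-- The inner product `⟨H|G⟩` of two basis vectors. -/
noncomputable def braket (H G : QGraph S K) : ℂ := ⟪ket H, ket G⟫_ℂ

/-- The matrix element `A_{GH} = ⟨G|A|H⟩`. -/
noncomputable def entry (A : Op S K) (G H : QGraph S K) : ℂ := ⟪ket G, A (ket H)⟫_ℂ

/-- The operator `|G⟩⟨H|`. -/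
noncomputable def ketBra (G H : QGraph S K) : Op S K :=
  InnerProductSpace.rankOne ℂ (ket G) (ket H)

/-- `A` is name-preserving: `⟨H|A|G⟩ = 0` unless `V(G) ≙ V(H)`. -/
def IsNamePreserving (A : Op S K) : Prop :=
  ∀ G H : QGraph S K, ¬ SameNames G.support H.support → entry A H G = 0

/-- Trace-class (equivalently, on a Hilbert space, nuclear) operators: the sums
`∑ₙ |xₙ⟩⟨yₙ|` with `∑ₙ ‖xₙ‖ ‖yₙ‖ < ∞`. -/
def IsTraceClass {E : Type*} [NormedAddCommGroup E] [InnerProductSpace ℂ E] (ρ : E →L[ℂ] E) : Prop :=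
  ∃ x y : ℕ → E, Summable (fun n => ‖x n‖ * ‖y n‖) ∧
    HasSum (fun n => InnerProductSpace.rankOne ℂ (x n) (y n)) ρ

/-- The partial trace of `|G⟩⟨H|`, namely `|G_χ⟩⟨H_χ| ⟨H_χ̄|G_χ̄⟩`. -/
noncomputable def partialTraceBasis (χ : Selection S K) (G H : QGraph S K) : Op S K :=
  braket (χ.compl H) (χ.compl G) • ketBra (χ G) (χ H)

/-- The partial trace `ρ_{|χ}`, the linear extension of the above:
`∑_{G,H} ρ_{GH} (|G⟩⟨H|)_{|χ}`. For a restriction `χ` and a trace-class `ρ` the family is summable in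
operator norm: grouping the nonzero terms by `L = G_χ̄ = H_χ̄`, on each group `G ↦ G_χ` is injective,
and the Hilbert-Schmidt norms of the groups have a finite sum. -/
noncomputable def partialTrace (χ : Selection S K) (ρ : Op S K) : Op S K :=
  ∑' p : QGraph S K × QGraph S K, entry ρ p.1 p.2 • partialTraceBasis χ p.1 p.2

/-- `ζ ⊑ χ`, `ζ` is comprehended within `χ`. -/
def Comprehended (ζ χ : Selection S K) : Prop :=
  (∀ G, χ.andThen ζ G = ζ G) ∧
  ∀ G H, braket (ζ.compl H) (ζ.compl G) =
    braket (χ.andThen ζ.compl H) (χ.andThen ζ.compl G) * braket (χ.compl H) (χ.compl G)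

/-- `U` is `χζ`-causal: `(U ρ U†)_{|ζ} = (U ρ_{|χ} U†)_{|ζ}` for every trace-class `ρ`. -/
def IsCausal (χ ζ : Selection S K) (U : Op S K) : Prop :=
  ∀ ρ : Op S K, IsTraceClass ρ →
    partialTrace ζ (U * ρ * ContinuousLinearMap.adjoint U) =
      partialTrace ζ (U * partialTrace χ ρ * ContinuousLinearMap.adjoint U)

/-! ### Operators over `ℋ_μ` -/

/-- `ℋ_μ`, the closed span of the basis vectors `|G_μ⟩`. -/
noncomputable abbrev subHilb (μ : Selection S K) : Submodule ℂ (Hilb S K) :=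
  (Submodule.span ℂ (Set.range fun G => ket (μ G))).topologicalClosure

/-- An operator over `ℋ_μ`, seen as an operator on `ℋ` that vanishes on the orthogonal complement
of `ℋ_μ`. -/
noncomputable def extendByZero (μ : Selection S K) (A : subHilb μ →L[ℂ] subHilb μ) : Op S K :=
  (subHilb μ).subtypeL ∘L A ∘L (subHilb μ).orthogonalProjectionOnto

/-- `U` is a `χζ`-causal operator over `ℋ_μ`: the causality equation holds for every trace-class
operator `ρ` over `ℋ_μ`. -/
def IsCausalOver (μ χ ζ : Selection S K) (U : subHilb μ →L[ℂ] subHilb μ) : Prop :=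
  ∀ ρ : subHilb μ →L[ℂ] subHilb μ, IsTraceClass ρ →
    partialTrace ζ
        (extendByZero μ U * extendByZero μ ρ * ContinuousLinearMap.adjoint (extendByZero μ U)) =
      partialTrace ζ
        (extendByZero μ U * partialTrace χ (extendByZero μ ρ) *
          ContinuousLinearMap.adjoint (extendByZero μ U))

/-! ### The tensor induced by a restriction -/

open scoped Classical in
/-- `|H⟩ ⊗_χ |H'⟩`: it is `|G⟩` if `H = G_χ` and `H' = G_χ̄` (such a `G` is unique, being `H ∪ H'`),
and zero if there is no such `G`. -/
noncomputable def tensorKet (χ : Selection S K) (H H' : QGraph S K) : Hilb S K :=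
  if h : ∃ G, χ G = H ∧ χ.compl G = H' then ket h.choose else 0

/-- `T = A ⊗_χ B`, the bilinear extension of
`|G⟩⟨H| ⊗_χ |G'⟩⟨H'| = (|G⟩ ⊗_χ |G'⟩)(⟨H| ⊗_χ ⟨H'|)`, that is
`T = ∑ A_{GH} B_{G'H'} (|G⟩ ⊗_χ |G'⟩)(⟨H| ⊗_χ ⟨H'|)` in the sense of matrix elements;
the summation index `q` is `((G, H), (G', H'))`. -/
def IsTensor (χ : Selection S K) (A B T : Op S K) : Prop :=
  ∀ C D : QGraph S K,
    HasSum (fun q : (QGraph S K × QGraph S K) × (QGraph S K × QGraph S K) =>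
      entry A q.1.1 q.1.2 * entry B q.2.1 q.2.2 *
        (⟪ket C, tensorKet χ q.1.1 q.2.1⟫_ℂ * ⟪tensorKet χ q.1.2 q.2.2, ket D⟫_ℂ))
      (entry T C D)

end Operators

end QNet

/-! A graph is the union of `G_χ` and `G_χ̄`, so `G ↦ (G_χ, G_χ̄)` is injective and a vector becomes
a family of coordinates indexed by compatible pairs of parts. Fixing the second part gives
contractions `K_L` (`keepSlice`), with `∑ ‖K_L x‖² = ‖x‖²`, and the partial trace takes the Kraus
form `ρ_{|χ} = ∑ K_L ρ K_L†`. Hence it preserves the trace class (`NuclearRep.restrict`). Its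
defining series converges unconditionally in operator norm (`summable_partialTrace`), so that its
matrix elements can be computed termwise.

(i) If `ζ ⊑ χ`, then `(ρ_{|χ})_{|ζ} = ρ_{|ζ}`: group the pairs `(G, H)` by `(G_χ, H_χ)`. Thus `ρ`
and `ρ_{|χ}` have the same `χ'` trace, and `χ'ζ'`-causality of `U` gives `UρU†` and `Uρ_{|χ}U†` the
same `ζ'` trace, hence the same `ζ` trace.

(ii) A pointwise `μ` is selection by a predicate on systems. Replacing `G_μ` by a graph with the
same names keeps `G` well-named (`exists_replace`), so a name-preserving `U` never sends `|G_μ⟩` to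
a graph incompatible with `G_μ̄`. The matrix `δ(C_μ̄, D_μ̄) ⟨C_μ|U|D_μ⟩` therefore has orthonormal
columns; so does the one built from `U†`, which is its adjoint, and unitarity follows. Causality
need only be tested on `|D⟩⟨E|` (`IsCausal.of_ketBra`). There the commutation hypotheses split every
condition into a `μ` part, settled by causality of `U`, and a `μ̄` part, on which `ξ` and `ζ` agree.
-/

namespace QNet

variable {S K : Type*}

/-! ### Coordinates in the basis of graphs -/

theorem inner_ket_left (G : QGraph S K) (x : Hilb S K) : ⟪ket G, x⟫_ℂ = x G := by
  classical
  simp [ket, lp.inner_single_left]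

theorem inner_ket_right (G : QGraph S K) (x : Hilb S K) : ⟪x, ket G⟫_ℂ = star (x G) := by
  rw [← inner_conj_symm, inner_ket_left]; rfl

open scoped Classical in
theorem ket_apply (G C : QGraph S K) : ket G C = if C = G then (1 : ℂ) else 0 := by
  by_cases h : C = G
  · subst h; simp [ket]
  · simp [ket, h]

open scoped Classical in
theorem braket_eq (H G : QGraph S K) : braket H G = if H = G then 1 else 0 := by
  rw [braket, inner_ket_left, ket_apply]

theorem entry_eq_apply (A : Op S K) (G H : QGraph S K) : entry A G H = A (ket H) G :=
  inner_ket_left _ _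

theorem hasSum_ket (x : Hilb S K) : HasSum (fun G => x G • ket G) x := by
  classical
  have h := lp.hasSum_single (E := fun _ : QGraph S K => ℂ) (p := 2) (by simp) x
  refine h.congr_fun fun G => ?_
  rw [ket, ← lp.single_smul, smul_eq_mul, mul_one]

theorem clm_ext_ket {E : Type*} [NormedAddCommGroup E] [NormedSpace ℂ E]
    {f g : Hilb S K →L[ℂ] E} (h : ∀ G, f (ket G) = g (ket G)) : f = g := by
  ext1 x
  have hf := (hasSum_ket x).mapL f
  have hg := (hasSum_ket x).mapL g
  simp only [map_smul, h] at hf hg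
  exact hf.unique hg

theorem op_ext {A B : Op S K} (h : ∀ G H, entry A G H = entry B G H) : A = B := by
  refine clm_ext_ket fun H => ?_
  ext G
  simpa [entry_eq_apply] using h G H

theorem entry_adjoint (A : Op S K) (G H : QGraph S K) :
    entry (ContinuousLinearMap.adjoint A) G H = star (entry A H G) := by
  rw [entry, entry, ContinuousLinearMap.adjoint_inner_right, ← inner_conj_symm]; rfl

/-- The matrix element as a continuous linear functional of the operator. -/
noncomputable def entryL (G H : QGraph S K) : Op S K →L[ℂ] ℂ :=
  (innerSL ℂ (ket G)) ∘L (ContinuousLinearMap.apply ℂ (Hilb S K) (ket H))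

theorem entryL_apply (G H : QGraph S K) (A : Op S K) : entryL G H A = entry A G H := rfl

theorem entry_smul (c : ℂ) (A : Op S K) (G H : QGraph S K) :
    entry (c • A) G H = c * entry A G H := (entryL G H).map_smul c A

theorem entry_rankOne (x y : Hilb S K) (G H : QGraph S K) :
    entry (InnerProductSpace.rankOne ℂ x y) G H = x G * star (y H) := by
  rw [entry_eq_apply, InnerProductSpace.rankOne_apply, inner_ket_right]
  simp [mul_comm]

open scoped Classical in
theorem entry_partialTraceBasis (χ : Selection S K) (G H A B : QGraph S K) :
    entry (partialTraceBasis χ G H) A B =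
      if χ.compl H = χ.compl G ∧ χ G = A ∧ χ H = B then 1 else 0 := by
  rw [partialTraceBasis, entry_smul, ketBra, entry_rankOne, braket_eq, ket_apply, ket_apply]
  simp only [eq_comm (a := A), eq_comm (a := B)]
  by_cases h1 : χ.compl H = χ.compl G <;> by_cases h2 : χ G = A <;> by_cases h3 : χ H = B <;>
    simp [h1, h2, h3]

/-! ### Splitting a graph along a selection -/

theorem QGraph.mem_sub {G : QGraph S K} {p : S × Vertex K → Prop} {s : S × Vertex K} :
    s ∈ (G.sub p).systems ↔ s ∈ G.systems ∧ p s := by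
  classical
  simp [QGraph.sub]

theorem QGraph.ext_mem {G H : QGraph S K} (h : ∀ s, s ∈ G.systems ↔ s ∈ H.systems) : G = H :=
  QGraph.ext (Finset.ext h)

theorem Selection.mem_compl {χ : Selection S K} {G : QGraph S K} {s : S × Vertex K} :
    s ∈ (χ.compl G).systems ↔ s ∈ G.systems ∧ s ∉ (χ G).systems := QGraph.mem_sub

theorem Selection.mem_union {χ ζ : Selection S K} {G : QGraph S K} {s : S × Vertex K} :
    s ∈ (χ.union ζ G).systems ↔ s ∈ (χ G).systems ∨ s ∈ (ζ G).systems := by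
  refine QGraph.mem_sub.trans ⟨fun h => h.2, fun h => ⟨?_, h⟩⟩
  exact h.elim (fun h => χ.subset _ h) (fun h => ζ.subset _ h)

theorem Selection.mem_iff {χ : Selection S K} {G : QGraph S K} {s : S × Vertex K} :
    s ∈ G.systems ↔ s ∈ (χ G).systems ∨ s ∈ (χ.compl G).systems := by
  rw [Selection.mem_compl]
  have := @χ.subset G s
  tauto

theorem Selection.eq_of_parts {χ : Selection S K} {G H : QGraph S K} (h : χ G = χ H)
    (h' : χ.compl G = χ.compl H) : G = H :=
  QGraph.ext_mem fun s => by rw [χ.mem_iff, h, h', ← χ.mem_iff]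

/-! ### Vectors as families indexed by pairs of parts -/

theorem tensorKet_parts (χ : Selection S K) (G : QGraph S K) :
    tensorKet χ (χ G) (χ.compl G) = ket G := by
  have h : ∃ C, χ C = χ G ∧ χ.compl C = χ.compl G := ⟨G, rfl, rfl⟩
  rw [tensorKet, dif_pos h, Selection.eq_of_parts h.choose_spec.1 h.choose_spec.2]

theorem tensorKet_eq_zero {χ : Selection S K} {A L : QGraph S K}
    (h : ¬ ∃ G, χ G = A ∧ χ.compl G = L) : tensorKet χ A L = 0 := dif_neg h

/-- The coordinate of `x` at `|A⟩ ⊗_χ |L⟩`. -/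
noncomputable def amp (χ : Selection S K) (x : Hilb S K) (p : QGraph S K × QGraph S K) : ℂ :=
  ⟪tensorKet χ p.1 p.2, x⟫_ℂ

theorem amp_parts (χ : Selection S K) (x : Hilb S K) (G : QGraph S K) :
    amp χ x (χ G, χ.compl G) = x G := by
  rw [amp, tensorKet_parts, inner_ket_left]

theorem amp_eq_zero {χ : Selection S K} (x : Hilb S K) {p : QGraph S K × QGraph S K}
    (h : ¬ ∃ G, χ G = p.1 ∧ χ.compl G = p.2) : amp χ x p = 0 := by
  rw [amp, tensorKet_eq_zero h, inner_zero_left]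

theorem parts_injective (χ : Selection S K) :
    Function.Injective fun G : QGraph S K => (χ G, χ.compl G) := fun G H h => by
  simp only [Prod.mk.injEq] at h
  exact Selection.eq_of_parts h.1 h.2

theorem hasSum_norm_sq (x : Hilb S K) : HasSum (fun G => ‖x G‖ ^ 2) (‖x‖ ^ 2) := by
  have h := lp.hasSum_norm (p := 2) (by simp) x
  simpa using h

/-- Parseval: pairs that are not the two parts of a graph contribute zero. -/
theorem hasSum_amp_sq (χ : Selection S K) (x : Hilb S K) :
    HasSum (fun p => ‖amp χ x p‖ ^ 2) (‖x‖ ^ 2) := by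
  refine ((parts_injective χ).hasSum_iff ?_).1 ?_
  · rintro p hp
    rw [amp_eq_zero, norm_zero, zero_pow two_ne_zero]
    rintro ⟨G, h1, h2⟩
    exact hp ⟨G, Prod.ext h1 h2⟩
  · exact (hasSum_norm_sq x).congr_fun fun G => by
      rw [Function.comp_apply, amp_parts]

/-- The vector of the coordinates of `x` along an injective family of pairs of parts. -/
noncomputable def sliceLinear (χ : Selection S K) (e : QGraph S K → QGraph S K × QGraph S K)
    (he : Function.Injective e) : Hilb S K →ₗ[ℂ] Hilb S K where
  toFun := fun x => ⟨fun A => amp χ x (e A), memℓp_gen (by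
        simpa [Function.comp_def] using (hasSum_amp_sq χ x).summable.comp_injective he)⟩
  map_add' := fun x y => by ext A; exact inner_add_right _ _ _
  map_smul' := fun c x => by ext A; exact inner_smul_right _ _ _

theorem sliceLinear_apply (χ : Selection S K) (e : QGraph S K → QGraph S K × QGraph S K)
    (he : Function.Injective e) (x : Hilb S K) (A : QGraph S K) :
    sliceLinear χ e he x A = amp χ x (e A) := rfl

theorem slice_bound (χ : Selection S K) (e : QGraph S K → QGraph S K × QGraph S K)
    (he : Function.Injective e) (x : Hilb S K) : ‖sliceLinear χ e he x‖ ≤ 1 * ‖x‖ := by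
  rw [one_mul]
  refine lp.norm_le_of_tsum_le (by simp) (norm_nonneg x) ?_
  have h := hasSum_amp_sq χ x
  simpa [← h.tsum_eq, Function.comp_def, sliceLinear_apply] using tsum_comp_le_tsum_of_inj h.summable (fun _ => by positivity) he

/-- `sliceLinear` as a bounded operator. -/
noncomputable def slice (χ : Selection S K) (e : QGraph S K → QGraph S K × QGraph S K)
    (he : Function.Injective e) : Op S K :=
  (sliceLinear χ e he).mkContinuous 1 (slice_bound χ e he)

/-- The operator `|G⟩ ↦ |G_χ⟩` if `G_χ̄ = L`, and `|G⟩ ↦ 0` otherwise. -/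
noncomputable def keepSlice (χ : Selection S K) (L : QGraph S K) : Op S K :=
  slice χ (fun A => (A, L)) fun _ _ h => (Prod.mk.inj h).1

/-- The operator `|G⟩ ↦ |G_χ̄⟩` if `G_χ = A`, and `|G⟩ ↦ 0` otherwise. -/
noncomputable def dropSlice (χ : Selection S K) (A : QGraph S K) : Op S K :=
  slice χ (fun L => (A, L)) fun _ _ h => (Prod.mk.inj h).2

theorem keepSlice_apply (χ : Selection S K) (L : QGraph S K) (x : Hilb S K) (A : QGraph S K) :
    keepSlice χ L x A = amp χ x (A, L) := rfl

theorem norm_dropSlice_le (χ : Selection S K) (A : QGraph S K) (x : Hilb S K) :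
    ‖dropSlice χ A x‖ ≤ ‖x‖ := by
  have h : ‖dropSlice χ A‖ ≤ 1 := LinearMap.mkContinuous_norm_le _ zero_le_one (slice_bound χ _ _)
  simpa using (dropSlice χ A).le_of_opNorm_le h x

open scoped Classical in
theorem keepSlice_ket (χ : Selection S K) (L G : QGraph S K) :
    keepSlice χ L (ket G) = if χ.compl G = L then ket (χ G) else 0 := by
  ext A
  rw [keepSlice_apply]
  by_cases h : ∃ C, χ C = A ∧ χ.compl C = L
  · obtain ⟨C, rfl, rfl⟩ := h
    rw [amp_parts, ket_apply]
    by_cases h1 : χ.compl G = χ.compl C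
    · rw [if_pos h1, ket_apply]
      refine if_congr ⟨fun h => h ▸ rfl, fun h => Selection.eq_of_parts h h1.symm⟩ rfl rfl
    · rw [if_neg h1, if_neg]
      · rfl
      · rintro rfl
        exact h1 rfl
  · rw [amp_eq_zero _ h]
    split_ifs with h1
    · rw [ket_apply, if_neg]
      rintro rfl
      exact h ⟨G, rfl, h1⟩
    · rfl

theorem hasSum_norm_keepSlice_sq (χ : Selection S K) (x : Hilb S K) :
    HasSum (fun L => ‖keepSlice χ L x‖ ^ 2) (‖x‖ ^ 2) :=
  ((Equiv.prodComm _ _).hasSum_iff.2 (hasSum_amp_sq χ x)).prod_fiberwise fun L =>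
    hasSum_norm_sq (keepSlice χ L x)

theorem summable_norm_keepSlice_mul (χ : Selection S K) (x y : Hilb S K) :
    Summable (fun L => ‖keepSlice χ L x‖ * ‖keepSlice χ L y‖) ∧
      ∑' L, ‖keepSlice χ L x‖ * ‖keepSlice χ L y‖ ≤ ‖x‖ * ‖y‖ := by
  have hx := hasSum_norm_keepSlice_sq χ x
  have hy := hasSum_norm_keepSlice_sq χ y
  have h := Real.summable_and_inner_le_Lp_mul_Lq_tsum_of_nonneg (Real.HolderConjugate.two_two)
    (fun L => norm_nonneg (keepSlice χ L x)) (fun L => norm_nonneg (keepSlice χ L y))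
    (by simpa using hx.summable) (by simpa using hy.summable)
  refine ⟨h.1, h.2.trans_eq ?_⟩
  simp only [Real.rpow_two, hx.tsum_eq, hy.tsum_eq, ← Real.sqrt_eq_rpow,
    Real.sqrt_sq (norm_nonneg _)]

/-! ### Nuclear representations -/

/-- `ρ = ∑ᵢ |xᵢ⟩⟨yᵢ|` with `∑ᵢ ‖xᵢ‖ ‖yᵢ‖ < ∞`, over an arbitrary index type. -/
def NuclearRep {ι E : Type*} [NormedAddCommGroup E] [InnerProductSpace ℂ E] (x y : ι → E)
    (ρ : E →L[ℂ] E) : Prop :=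
  Summable (fun i => ‖x i‖ * ‖y i‖) ∧ HasSum (fun i => InnerProductSpace.rankOne ℂ (x i) (y i)) ρ

theorem NuclearRep.isTraceClass {ι E : Type*} [NormedAddCommGroup E] [InnerProductSpace ℂ E]
    {x y : ι → E} {ρ : E →L[ℂ] E} (h : NuclearRep x y ρ) : IsTraceClass ρ := by
  -- A summable family has countable support, so the nonzero terms inject into `ℕ`; the other
  -- naturals carry the zero vector.
  let s := Function.support fun i => ‖x i‖ * ‖y i‖
  have hs : s.Countable := h.1.countable_support
  obtain ⟨f, hf⟩ := Set.countable_iff_exists_injective.1 hs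
  have h0 : ∀ i ∉ s, InnerProductSpace.rankOne ℂ (x i) (y i) = 0 := fun i hi => by
    have h0 : ‖x i‖ * ‖y i‖ = 0 := Function.notMem_support.1 hi
    rw [InnerProductSpace.rankOne_eq_zero]
    simpa using h0
  refine ⟨Function.extend f (fun i => x i) 0, Function.extend f (fun i => y i) 0, ?_, ?_⟩
  · refine (hf.summable_iff fun n hn => ?_).1 ?_
    · rw [Function.extend_apply' _ _ _ hn]; simp
    · refine (h.1.subtype s).congr fun i => ?_
      simp [hf.extend_apply]
  · refine (hf.hasSum_iff fun n hn => ?_).1 ?_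
    · rw [Function.extend_apply' _ _ _ hn]; simp
    · refine ((hasSum_subtype_iff_of_support_subset (s := s) fun i hi => ?_).2 h.2).congr_fun
        fun i => ?_
      · by_contra hc
        exact hi (h0 i hc)
      · simp [hf.extend_apply]

theorem isTraceClass_rankOne {E : Type*} [NormedAddCommGroup E] [InnerProductSpace ℂ E] (x y : E) :
    IsTraceClass (InnerProductSpace.rankOne ℂ x y) :=
  NuclearRep.isTraceClass (ι := Unit) (x := fun _ => x) (y := fun _ => y)
    ⟨Summable.of_finite, by simp⟩

theorem NuclearRep.exists_of_summable {ι : Type*} {x y : ι → Hilb S K}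
    (h : Summable fun i => ‖x i‖ * ‖y i‖) : ∃ ρ : Op S K, NuclearRep x y ρ := by
  have : Summable fun i => InnerProductSpace.rankOne ℂ (x i) (y i) :=
    Summable.of_norm (by simpa using h)
  exact ⟨_, h, this.hasSum⟩

theorem NuclearRep.conj {ι : Type*} {x y : ι → Hilb S K} {ρ : Op S K} (h : NuclearRep x y ρ)
    (U : Op S K) : NuclearRep (fun i => U (x i)) (fun i => U (y i))
      (U * ρ * ContinuousLinearMap.adjoint U) := by
  refine ⟨?_, ?_⟩
  · refine Summable.of_nonneg_of_le (fun i => by positivity) (fun i => ?_)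
      (h.1.mul_left (‖U‖ * ‖U‖))
    calc ‖U (x i)‖ * ‖U (y i)‖ ≤ (‖U‖ * ‖x i‖) * (‖U‖ * ‖y i‖) := by
          gcongr <;> exact U.le_opNorm _
      _ = _ := by ring
  · refine ((h.2.mul_left U).mul_right (ContinuousLinearMap.adjoint U)).congr_fun fun i => ?_
    ext1 z
    simp [ContinuousLinearMap.adjoint_inner_right]

theorem NuclearRep.hasSum_entry {ι : Type*} {x y : ι → Hilb S K} {ρ : Op S K}
    (h : NuclearRep x y ρ) (G H : QGraph S K) :
    HasSum (fun i => x i G * star (y i H)) (entry ρ G H) := by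
  simpa [entryL_apply, entry_rankOne] using h.2.mapL (entryL G H)

theorem IsTraceClass.conj {ρ : Op S K} (h : IsTraceClass ρ) (U : Op S K) :
    IsTraceClass (U * ρ * ContinuousLinearMap.adjoint U) := by
  obtain ⟨x, y, h⟩ := h
  exact (NuclearRep.conj h U).isTraceClass

/-! ### Summability of the partial trace -/

/-- The weight `‖yᵢ‖ / ‖xᵢ‖` turns `‖xᵢ‖²` into `‖xᵢ‖ ‖yᵢ‖`, also when `xᵢ = 0`. -/
theorem summable_weighted {ι : Type*} {x y : ι → Hilb S K} (h : Summable fun i => ‖x i‖ * ‖y i‖) :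
    Summable fun q : ι × QGraph S K => ‖x q.1 q.2‖ ^ 2 * (‖y q.1‖ / ‖x q.1‖) := by
  have hs : ∀ i, HasSum (fun G => ‖x i G‖ ^ 2 * (‖y i‖ / ‖x i‖)) (‖x i‖ * ‖y i‖) := fun i => by
    have := (hasSum_norm_sq (x i)).mul_right (‖y i‖ / ‖x i‖)
    have hr : ∀ r t : ℝ, r ^ 2 * (t / r) = r * t := fun r t => by
      rcases eq_or_ne r 0 with rfl | h0
      · simp
      · field_simp
    rwa [hr] at this
  refine (summable_prod_of_nonneg fun q => by positivity).2 ⟨fun i => (hs i).summable, ?_⟩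
  exact h.congr fun i => (hs i).tsum_eq.symm

/-- The matrix elements of a trace-class operator are dominated by those of a rank one operator. -/
theorem NuclearRep.exists_dominated {ι : Type*} {x y : ι → Hilb S K} {ρ : Op S K}
    (h : NuclearRep x y ρ) : ∃ X Y : QGraph S K → ℝ,
      Summable (fun G => X G ^ 2) ∧ Summable (fun H => Y H ^ 2) ∧
      ∀ G H, ‖entry ρ G H‖ ≤ X G * Y H := by
  -- The two weights are reciprocal, so `a G i * b H i = (‖xᵢ G‖ ‖yᵢ H‖)²`, and Cauchy-Schwarz over
  -- `i` separates `G` from `H`.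
  let a : QGraph S K → ι → ℝ := fun G i => ‖x i G‖ ^ 2 * (‖y i‖ / ‖x i‖)
  let b : QGraph S K → ι → ℝ := fun H i => ‖y i H‖ ^ 2 * (‖x i‖ / ‖y i‖)
  have ha0 : ∀ G i, 0 ≤ a G i := fun G i => by positivity
  have hb0 : ∀ G i, 0 ≤ b G i := fun G i => by positivity
  have ha : Summable fun q : QGraph S K × ι => a q.1 q.2 :=
    (Equiv.prodComm _ _).summable_iff.2 (summable_weighted h.1)
  have hb : Summable fun q : QGraph S K × ι => b q.1 q.2 :=
    (Equiv.prodComm _ _).summable_iff.2 (summable_weighted (by simpa [mul_comm] using h.1))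
  refine ⟨fun G => √(∑' i, a G i), fun H => √(∑' i, b H i), ?_, ?_, fun G H => ?_⟩
  · exact ha.prod.congr fun G => (Real.sq_sqrt (tsum_nonneg (ha0 G))).symm
  · exact hb.prod.congr fun G => (Real.sq_sqrt (tsum_nonneg (hb0 G))).symm
  · refine le_of_tendsto (h.hasSum_entry G H).norm (Filter.Eventually.of_forall fun s => ?_)
    calc ‖∑ i ∈ s, x i G * star (y i H)‖ ≤ ∑ i ∈ s, √(a G i) * √(b H i) := by
          refine (norm_sum_le _ _).trans (Finset.sum_le_sum fun i _ => ?_)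
          rw [← Real.sqrt_mul (ha0 G i), norm_mul, norm_star]
          refine Real.le_sqrt_of_sq_le (le_of_eq ?_)
          rcases eq_or_ne ‖x i‖ 0 with h0 | h0
          · have : x i = 0 := by simpa using h0
            simp [a, b, this]
          rcases eq_or_ne ‖y i‖ 0 with h1 | h1
          · have : y i = 0 := by simpa using h1
            simp [a, b, this]
          simp only [a, b]
          field_simp
      _ ≤ √(∑ i ∈ s, a G i) * √(∑ i ∈ s, b H i) :=
          Real.sum_sqrt_mul_sqrt_le _ (ha0 G) (hb0 H)
      _ ≤ _ := by
          refine mul_le_mul (Real.sqrt_le_sqrt ?_) (Real.sqrt_le_sqrt ?_) (Real.sqrt_nonneg _)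
            (Real.sqrt_nonneg _)
          · exact (ha.prod_factor G).sum_le_tsum _ fun i _ => ha0 G i
          · exact (hb.prod_factor H).sum_le_tsum _ fun i _ => hb0 H i

/-- Once `p.1` is fixed, the complement of `p.2` is known, so `χ p.2` determines `p.2`: each fibre
visits a coordinate of `v` at most once. -/
theorem sum_fiber_le (χ : Selection S K) (F : Finset (QGraph S K × QGraph S K))
    (hF : ∀ p ∈ F, χ.compl p.2 = χ.compl p.1) (X : QGraph S K → ℝ) (v : Hilb S K)
    {a : ℝ} (ha : ∀ T : Finset (QGraph S K), (∀ G ∈ T, ∃ p ∈ F, p.1 = G) → ∑ G ∈ T, X G ^ 2 ≤ a) :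
    ∑ p ∈ F, (X p.1 * ‖v (χ p.2)‖) ^ 2 ≤ a * ‖v‖ ^ 2 := by
  classical
  have hm : ∀ p ∈ F, p.1 ∈ F.image Prod.fst := fun p hp => Finset.mem_image_of_mem _ hp
  rw [← Finset.sum_fiberwise_of_maps_to hm]
  calc _ ≤ ∑ G ∈ F.image Prod.fst, X G ^ 2 * ‖v‖ ^ 2 := by
        refine Finset.sum_le_sum fun G _ => ?_
        have hinj : Set.InjOn (fun p : QGraph S K × QGraph S K => χ p.2)
            (F.filter fun p => p.1 = G) := by
          intro p hp q hq hpq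
          simp only [Finset.coe_filter, Set.mem_ofPred_eq] at hp hq
          refine Prod.ext (hp.2.trans hq.2.symm) (Selection.eq_of_parts hpq ?_)
          rw [hF p hp.1, hF q hq.1, hp.2, hq.2]
        calc _ = ∑ p ∈ F.filter fun p => p.1 = G, X G ^ 2 * ‖v (χ p.2)‖ ^ 2 := by
              refine Finset.sum_congr rfl fun p hp => ?_
              rw [(Finset.mem_filter.1 hp).2, mul_pow]
          _ = X G ^ 2 * ∑ A ∈ (F.filter fun p => p.1 = G).image fun p => χ p.2, ‖v A‖ ^ 2 := by
              rw [Finset.sum_image hinj, Finset.mul_sum]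
          _ ≤ _ := by
              gcongr
              exact sum_le_hasSum _ (fun _ _ => by positivity) (hasSum_norm_sq v)
    _ ≤ _ := by
        rw [← Finset.sum_mul]
        gcongr
        exact ha _ fun G hG => by simpa using hG

theorem opNorm_le_of_inner {T : Op S K} {C : ℝ} (hC : 0 ≤ C)
    (h : ∀ u v : Hilb S K, ‖⟪u, T v⟫_ℂ‖ ≤ C * ‖u‖ * ‖v‖) : ‖T‖ ≤ C := by
  refine T.opNorm_le_bound hC fun v => ?_
  have h1 := h (T v) v
  rw [inner_self_eq_norm_sq_to_K] at h1
  rcases eq_or_lt_of_le (norm_nonneg (T v)) with h0 | h0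
  · rw [← h0]; positivity
  · simp only [Complex.coe_algebraMap, norm_pow, Complex.norm_real, norm_norm] at h1
    nlinarith

/-- The bound involves only the rows and columns that `F` meets, which is what makes the tails of
the series small. -/
theorem norm_sum_partialTrace_le (χ : Selection S K) {ρ : Op S K} {X Y : QGraph S K → ℝ}
    (hρ : ∀ G H, ‖entry ρ G H‖ ≤ X G * Y H)
    (F : Finset (QGraph S K × QGraph S K)) {a b : ℝ} (ha0 : 0 ≤ a) (hb0 : 0 ≤ b)
    (ha : ∀ T : Finset (QGraph S K), (∀ G ∈ T, ∃ p ∈ F, p.1 = G) → ∑ G ∈ T, X G ^ 2 ≤ a)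
    (hb : ∀ T : Finset (QGraph S K), (∀ G ∈ T, ∃ p ∈ F, p.2 = G) → ∑ G ∈ T, Y G ^ 2 ≤ b) :
    ‖∑ p ∈ F, entry ρ p.1 p.2 • partialTraceBasis χ p.1 p.2‖ ≤ √a * √b := by
  classical
  let F' := F.filter fun p => χ.compl p.2 = χ.compl p.1
  have hF' : ∀ p ∈ F', χ.compl p.2 = χ.compl p.1 := fun p hp => (Finset.mem_filter.1 hp).2
  have hF'F : ∀ p ∈ F', p ∈ F := fun p hp => (Finset.mem_filter.1 hp).1
  refine opNorm_le_of_inner (by positivity) fun u v => ?_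
  have h1 : ⟪u, (∑ p ∈ F, entry ρ p.1 p.2 • partialTraceBasis χ p.1 p.2) v⟫_ℂ =
      ∑ p ∈ F', entry ρ p.1 p.2 * (v (χ p.2) * star (u (χ p.1))) := by
    rw [Finset.sum_filter, sum_apply, inner_sum]
    refine Finset.sum_congr rfl fun p _ => ?_
    rw [partialTraceBasis, braket_eq, ketBra]
    split_ifs
    · simp [inner_smul_right, inner_ket_left, inner_ket_right]
    · simp
  have hu := sum_fiber_le χ (F'.image Prod.swap) (fun p hp => by
      obtain ⟨q, hq, rfl⟩ := Finset.mem_image.1 hp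
      exact (hF' q hq).symm) Y u (a := b) fun T hT => hb T fun G hG => by
        obtain ⟨p, hp, rfl⟩ := hT G hG
        obtain ⟨q, hq, rfl⟩ := Finset.mem_image.1 hp
        exact ⟨q, hF'F q hq, rfl⟩
  rw [Finset.sum_image fun _ _ _ _ h => Prod.swap_injective h] at hu
  have hv := sum_fiber_le χ F' hF' X v (a := a) fun T hT => ha T fun G hG => by
    obtain ⟨p, hp, rfl⟩ := hT G hG
    exact ⟨p, hF'F p hp, rfl⟩
  rw [h1]
  -- The factors are paired crosswise, `X` at `p.1` with `v` at `p.2`, so that both Cauchy-Schwarz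
  -- factors are fibre sums as in `sum_fiber_le`.
  calc _ ≤ ∑ p ∈ F', (X p.1 * ‖v (χ p.2)‖) * (Y p.2 * ‖u (χ p.1)‖) := by
        refine (norm_sum_le _ _).trans (Finset.sum_le_sum fun p _ => ?_)
        rw [norm_mul, norm_mul, norm_star]
        calc _ ≤ (X p.1 * Y p.2) * (‖v (χ p.2)‖ * ‖u (χ p.1)‖) := by
              gcongr
              exact hρ _ _
          _ = _ := by ring
    _ ≤ √(∑ p ∈ F', (X p.1 * ‖v (χ p.2)‖) ^ 2) * √(∑ p ∈ F', (Y p.2 * ‖u (χ p.1)‖) ^ 2) :=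
        Real.sum_mul_le_sqrt_mul_sqrt _ _ _
    _ ≤ √(a * ‖v‖ ^ 2) * √(b * ‖u‖ ^ 2) := by
        gcongr
        exact hu
    _ = _ := by
        rw [Real.sqrt_mul ha0, Real.sqrt_mul hb0, Real.sqrt_sq (norm_nonneg _),
          Real.sqrt_sq (norm_nonneg _)]
        ring

theorem exists_finset_sqrt_tail {X : QGraph S K → ℝ} (h : Summable fun G => X G ^ 2) {ε : ℝ}
    (hε : 0 < ε) : ∃ s : Finset (QGraph S K), ∀ T, Disjoint T s → ∑ G ∈ T, X G ^ 2 ≤ ε ^ 2 := by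
  obtain ⟨s, hs⟩ := summable_iff_vanishing_norm.1 h (ε ^ 2) (by positivity)
  exact ⟨s, fun T hT => (Real.le_norm_self _).trans (hs T hT).le⟩

theorem summable_partialTrace (χ : Selection S K) {ρ : Op S K} (h : IsTraceClass ρ) :
    Summable fun p : QGraph S K × QGraph S K =>
      entry ρ p.1 p.2 • partialTraceBasis χ p.1 p.2 := by
  classical
  obtain ⟨x, y, h⟩ := h
  obtain ⟨X, Y, hXs, hYs, hρ⟩ := NuclearRep.exists_dominated h
  rw [summable_iff_vanishing_norm]
  intro ε hε
  set a := ∑' G, X G ^ 2 with ha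
  set b := ∑' G, Y G ^ 2 with hb
  have ha0 : 0 ≤ a := tsum_nonneg fun _ => by positivity
  have hb0 : 0 ≤ b := tsum_nonneg fun _ => by positivity
  -- Chosen so that `√a * δ + δ * √b < ε`.
  set δ := ε / (2 * (√a + √b + 1)) with hδ
  have hδ0 : 0 < δ := by positivity
  obtain ⟨s, hs⟩ := exists_finset_sqrt_tail hXs hδ0
  obtain ⟨t, ht⟩ := exists_finset_sqrt_tail hYs hδ0
  refine ⟨s ×ˢ t, fun F hF => ?_⟩
  -- A pair outside `s ×ˢ t` has its second entry outside `t`, or its first outside `s`; each half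
  -- has one small factor.
  rw [← Finset.sum_filter_add_sum_filter_not F fun p => p.1 ∈ s]
  have h1 := norm_sum_partialTrace_le χ hρ (F.filter fun p => p.1 ∈ s) ha0
    (sq_nonneg δ) (fun T _ => hXs.sum_le_tsum _ fun _ _ => by positivity) fun T hT => by
      refine ht T (Finset.disjoint_left.2 fun G hG hGt => ?_)
      obtain ⟨p, hp, rfl⟩ := hT G hG
      rw [Finset.mem_filter] at hp
      exact Finset.disjoint_left.1 hF hp.1 (Finset.mem_product.2 ⟨hp.2, hGt⟩)
  have h2 := norm_sum_partialTrace_le χ hρ (F.filter fun p => p.1 ∉ s) (sq_nonneg δ) hb0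
    (fun T hT => by
      refine hs T (Finset.disjoint_left.2 fun G hG hGs => ?_)
      obtain ⟨p, hp, rfl⟩ := hT G hG
      exact (Finset.mem_filter.1 hp).2 hGs)
    (fun T _ => hYs.sum_le_tsum _ fun _ _ => by positivity)
  rw [Real.sqrt_sq hδ0.le] at h1 h2
  calc _ ≤ √a * δ + δ * √b := (norm_add_le _ _).trans (add_le_add h1 h2)
    _ < (2 * (√a + √b + 1)) * δ := by nlinarith [Real.sqrt_nonneg a, Real.sqrt_nonneg b]
    _ = ε := by rw [hδ]; field_simp

open scoped Classical in
/-- The matrix elements of the partial trace. -/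
theorem hasSum_entry_partialTrace (χ : Selection S K) {ρ : Op S K} (h : IsTraceClass ρ)
    (A B : QGraph S K) :
    HasSum (fun p : QGraph S K × QGraph S K => entry ρ p.1 p.2 *
      if χ.compl p.2 = χ.compl p.1 ∧ χ p.1 = A ∧ χ p.2 = B then 1 else 0)
      (entry (partialTrace χ ρ) A B) := by
  have := (summable_partialTrace χ h).hasSum.mapL (entryL A B)
  simp only [entryL_apply, entry_smul, entry_partialTraceBasis] at this
  exact this

/-! ### Partial traces of nuclear representations -/

theorem NuclearRep.hasSum_inner {ι : Type*} {x y : ι → Hilb S K} {ρ : Op S K}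
    (h : NuclearRep x y ρ) (u v : Hilb S K) :
    HasSum (fun i => ⟪u, x i⟫_ℂ * star ⟪v, y i⟫_ℂ) ⟪u, ρ v⟫_ℂ := by
  have := h.2.mapL ((innerSL ℂ u) ∘L (ContinuousLinearMap.apply ℂ (Hilb S K) v))
  refine this.congr_fun fun i => ?_
  have hs : star ⟪v, y i⟫_ℂ = ⟪y i, v⟫_ℂ := inner_conj_symm _ _
  simp [hs, mul_comm]

theorem hasSum_mul_star (u v : Hilb S K) : HasSum (fun L => v L * star (u L)) ⟪u, v⟫_ℂ :=
  lp.hasSum_inner u v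

theorem summable_norm_apply_mul (u v : Hilb S K) :
    Summable (fun L => ‖u L‖ * ‖v L‖) ∧ ∑' L, ‖u L‖ * ‖v L‖ ≤ ‖u‖ * ‖v‖ := by
  have h2 : (2 : ENNReal).toReal.HolderConjugate (2 : ENNReal).toReal := by
    simpa using Real.HolderConjugate.two_two
  exact ⟨lp.summable_mul h2 u v, lp.tsum_mul_le_mul_norm' h2 u v⟩

/-- A nonzero term of the double sum has parts `A` and `B` and a common complement `L`, which
determines the pair. -/
theorem hasSum_entry_partialTrace_tensorKet (χ : Selection S K) {ρ : Op S K} (h : IsTraceClass ρ)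
    (A B : QGraph S K) :
    HasSum (fun L => ⟪tensorKet χ A L, ρ (tensorKet χ B L)⟫_ℂ) (entry (partialTrace χ ρ) A B) := by
  classical
  refine (hasSum_iff_hasSum_of_ne_zero_bij (fun p => χ.compl p.1.1) ?_ ?_ ?_).2
    (hasSum_entry_partialTrace χ h A B)
  · rintro ⟨p, hp⟩ ⟨q, hq⟩ hpq
    simp only [Function.mem_support, ne_eq, mul_eq_zero, ite_eq_right_iff, one_ne_zero, imp_false,
      not_or, not_not] at hp hq hpq
    obtain ⟨-, hp1, hp2, hp3⟩ := hp
    obtain ⟨-, hq1, hq2, hq3⟩ := hq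
    refine Subtype.ext (Prod.ext ?_ ?_)
    · exact Selection.eq_of_parts (hp2.trans hq2.symm) hpq
    · exact Selection.eq_of_parts (hp3.trans hq3.symm) (by rw [hp1, hq1, hpq])
  · intro L hL
    have hG : ∃ G, χ G = A ∧ χ.compl G = L := by
      by_contra hc
      exact hL (by simp [tensorKet_eq_zero hc])
    have hH : ∃ H, χ H = B ∧ χ.compl H = L := by
      by_contra hc
      exact hL (by simp [tensorKet_eq_zero hc])
    obtain ⟨G, rfl, rfl⟩ := hG
    obtain ⟨H, rfl, hHG⟩ := hH
    refine ⟨⟨(G, H), ?_⟩, rfl⟩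
    rw [Function.mem_support] at hL ⊢
    nth_rewrite 2 [← hHG] at hL
    rw [tensorKet_parts, tensorKet_parts] at hL
    simpa [hHG, entry] using hL
  · rintro ⟨p, hp⟩
    simp only [Function.mem_support, ne_eq, mul_eq_zero, ite_eq_right_iff, one_ne_zero, imp_false,
      not_or, not_not] at hp
    obtain ⟨-, hp1, rfl, rfl⟩ := hp
    simp only [hp1, and_self, if_true, mul_one]
    nth_rewrite 2 [← hp1]
    rw [tensorKet_parts, tensorKet_parts]
    rfl

/-- The sums over `i` and over the complement `L` are exchanged; Cauchy-Schwarz in `L` bounds the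
double series by `∑ ‖xᵢ‖ ‖yᵢ‖`. -/
theorem NuclearRep.hasSum_entry_partialTrace {ι : Type*} {x y : ι → Hilb S K} {ρ : Op S K}
    (h : NuclearRep x y ρ) (χ : Selection S K) (A B : QGraph S K) :
    HasSum (fun i => ⟪dropSlice χ B (y i), dropSlice χ A (x i)⟫_ℂ)
      (entry (partialTrace χ ρ) A B) := by
  have hs : Summable fun q : ι × QGraph S K =>
      amp χ (x q.1) (A, q.2) * star (amp χ (y q.1) (B, q.2)) := by
    refine Summable.of_norm ?_
    simp only [norm_mul, norm_star]
    refine (summable_prod_of_nonneg fun q => by positivity).2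
      ⟨fun i => (summable_norm_apply_mul (dropSlice χ A (x i)) (dropSlice χ B (y i))).1, ?_⟩
    refine Summable.of_nonneg_of_le (fun i => tsum_nonneg fun L => by positivity) (fun i => ?_) h.1
    refine (summable_norm_apply_mul (dropSlice χ A (x i)) (dropSlice χ B (y i))).2.trans ?_
    exact mul_le_mul (norm_dropSlice_le _ _ _) (norm_dropSlice_le _ _ _) (norm_nonneg _)
      (norm_nonneg _)
  obtain ⟨T, hT⟩ := hs
  have h1 : HasSum (fun i => ⟪dropSlice χ B (y i), dropSlice χ A (x i)⟫_ℂ) T :=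
    hT.prod_fiberwise fun i => hasSum_mul_star (dropSlice χ B (y i)) (dropSlice χ A (x i))
  have hT' : HasSum (fun q : QGraph S K × ι =>
      amp χ (x q.2) (A, q.1) * star (amp χ (y q.2) (B, q.1))) T :=
    (Equiv.prodComm _ _).hasSum_iff.2 hT
  have h2 : HasSum (fun L => ⟪tensorKet χ A L, ρ (tensorKet χ B L)⟫_ℂ) T :=
    hT'.prod_fiberwise fun L => h.hasSum_inner (tensorKet χ A L) (tensorKet χ B L)
  rwa [h2.unique (hasSum_entry_partialTrace_tensorKet χ h.isTraceClass A B)] at h1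

/-- The Kraus form of the partial trace. The sliced family is nuclear by Cauchy-Schwarz over `L`,
and its sum is identified by matrix elements. -/
theorem NuclearRep.restrict {ι : Type*} {x y : ι → Hilb S K} {ρ : Op S K}
    (h : NuclearRep x y ρ) (χ : Selection S K) :
    NuclearRep (fun q : ι × QGraph S K => keepSlice χ q.2 (x q.1))
      (fun q => keepSlice χ q.2 (y q.1)) (partialTrace χ ρ) := by
  have hs : Summable fun q : ι × QGraph S K =>
      ‖keepSlice χ q.2 (x q.1)‖ * ‖keepSlice χ q.2 (y q.1)‖ := by
    refine (summable_prod_of_nonneg fun q => by positivity).2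
      ⟨fun i => (summable_norm_keepSlice_mul χ (x i) (y i)).1, ?_⟩
    exact Summable.of_nonneg_of_le (fun i => tsum_nonneg fun L => by positivity)
      (fun i => (summable_norm_keepSlice_mul χ (x i) (y i)).2) h.1
  obtain ⟨σ, hσ⟩ := NuclearRep.exists_of_summable hs
  suffices σ = partialTrace χ ρ from this ▸ hσ
  refine op_ext fun A B => ?_
  refine HasSum.unique ?_ (h.hasSum_entry_partialTrace χ A B)
  exact (hσ.hasSum_entry A B).prod_fiberwise fun i =>
    hasSum_mul_star (dropSlice χ B (y i)) (dropSlice χ A (x i))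

theorem IsTraceClass.restrict {ρ : Op S K} (h : IsTraceClass ρ) (χ : Selection S K) :
    IsTraceClass (partialTrace χ ρ) := by
  obtain ⟨x, y, h⟩ := h
  exact (NuclearRep.restrict h χ).isTraceClass

/-! ### Comprehension, composition of partial traces, and part (i) -/

theorem Comprehended.compl_eq_iff {ζ χ : Selection S K} (h : Comprehended ζ χ) (G H : QGraph S K) :
    ζ.compl H = ζ.compl G ↔ ζ.compl (χ H) = ζ.compl (χ G) ∧ χ.compl H = χ.compl G := by
  classical
  have := h.2 G H
  -- Brackets of basis vectors are 0 or 1, so their product is a conjunction.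
  simp only [braket_eq, Selection.andThen] at this
  by_cases h1 : ζ.compl (χ H) = ζ.compl (χ G) <;> by_cases h2 : χ.compl H = χ.compl G <;>
    by_cases h3 : ζ.compl H = ζ.compl G <;> simp_all

/-- Partial traces compose along comprehension. -/
theorem Comprehended.partialTrace_partialTrace {ζ χ : Selection S K} (h : Comprehended ζ χ)
    {ρ : Op S K} (hρ : IsTraceClass ρ) :
    partialTrace ζ (partialTrace χ ρ) = partialTrace ζ ρ := by
  classical
  refine op_ext fun A B => ?_
  -- The outer sum runs over the values of `(G_χ, H_χ)`, the inner one over the fibres.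
  have h1 := (hasSum_entry_partialTrace ζ hρ A B).tsum_fiberwise
    fun p : QGraph S K × QGraph S K => (χ p.1, χ p.2)
  refine HasSum.unique ?_ h1
  refine (hasSum_entry_partialTrace ζ (hρ.restrict χ) A B).congr_fun fun q => ?_
  rw [← (hasSum_entry_partialTrace χ hρ q.1 q.2).tsum_eq, ← tsum_mul_right]
  rw [← tsum_subtype_eq_of_support_subset
    (s := (fun p : QGraph S K × QGraph S K => (χ p.1, χ p.2)) ⁻¹' {q}) fun p hp => ?_]
  · refine tsum_congr fun p => ?_
    obtain ⟨⟨G, H⟩, hp⟩ := p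
    obtain rfl : (χ G, χ H) = q := hp
    have hG : ζ (χ G) = ζ G := h.1 G
    have hH : ζ (χ H) = ζ H := h.1 H
    have hc := h.compl_eq_iff G H
    simp only [hc, hG, hH, mul_assoc]
    congr 1
    by_cases h1 : ζ.compl (χ H) = ζ.compl (χ G) <;> by_cases h2 : χ.compl H = χ.compl G <;>
      simp [h1, h2]
  · simp only [Function.mem_support, ne_eq, mul_eq_zero, ite_eq_right_iff, one_ne_zero, imp_false,
      not_or, not_not] at hp
    exact Prod.ext hp.1.2.2.1 hp.1.2.2.2

theorem IsCausal.of_comprehended {χ' ζ' χ ζ : Selection S K} (hχ : Comprehended χ' χ)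
    (hζ : Comprehended ζ ζ') {U : Op S K} (hU : IsCausal χ' ζ' U) : IsCausal χ ζ U := by
  intro ρ hρ
  have h1 := hU ρ hρ
  have h2 := hU _ (hρ.restrict χ)
  rw [hχ.partialTrace_partialTrace hρ] at h2
  rw [← hζ.partialTrace_partialTrace (hρ.conj U), h1, ← h2,
    hζ.partialTrace_partialTrace ((hρ.restrict χ).conj U)]

/-! ### Causality on basis operators -/

theorem partialTrace_smul (χ : Selection S K) (c : ℂ) (ρ : Op S K) :
    partialTrace χ (c • ρ) = c • partialTrace χ ρ := by
  rw [partialTrace, partialTrace, ← tsum_const_smul'']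
  simp only [entry_smul, mul_smul]

theorem partialTrace_ketBra (χ : Selection S K) (D E : QGraph S K) :
    partialTrace χ (ketBra D E) = partialTraceBasis χ D E := by
  classical
  rw [partialTrace, tsum_eq_single (D, E)]
  · simp [ketBra, entry_rankOne, ket_apply]
  · intro p hp
    have : entry (ketBra D E) p.1 p.2 = 0 := by
      rw [ketBra, entry_rankOne, ket_apply, ket_apply]
      by_cases h1 : p.1 = D
      · rw [if_neg (fun h2 : p.2 = E => hp (Prod.ext h1 h2))]; simp
      · simp [h1]
    rw [this, zero_smul]

open scoped Classical in
/-- An operator that acts only on the `χ` part is the sum of its compressions. -/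
theorem hasSum_inner_keepSlice (χ : Selection S K) {P : Op S K}
    (hP : ∀ D E, entry P E D = if χ.compl E = χ.compl D then entry P (χ E) (χ D) else 0)
    (x y : Hilb S K) :
    HasSum (fun L => ⟪keepSlice χ L y, P (keepSlice χ L x)⟫_ℂ) ⟪y, P x⟫_ℂ := by
  -- By `hP`, the coordinate of `P x` at `E` sees only the slice of `x` with the same complement as
  -- `E`.
  have h1 : ∀ E, P x E = P (keepSlice χ (χ.compl E) x) (χ E) := fun E => by
    have h : innerSL ℂ (ket E) ∘L P =
        innerSL ℂ (ket (χ E)) ∘L P ∘L keepSlice χ (χ.compl E) := clm_ext_ket fun D => by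
      have := hP D E
      simp only [entry] at this
      simp only [ContinuousLinearMap.comp_apply, innerSL_apply_apply, this, keepSlice_ket,
        eq_comm (a := χ.compl D)]
      split_ifs <;> simp
    simpa [inner_ket_left] using congrArg (fun f => f x) h
  have h2 : HasSum (fun p : QGraph S K × QGraph S K =>
      ⟪amp χ y p, P (keepSlice χ p.2 x) p.1⟫_ℂ) ⟪y, P x⟫_ℂ := by
    refine ((parts_injective χ).hasSum_iff fun p hp => ?_).1 ?_
    · rw [amp_eq_zero, inner_zero_left]
      rintro ⟨G, h1, h2⟩
      exact hp ⟨G, Prod.ext h1 h2⟩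
    · refine (lp.hasSum_inner y (P x)).congr_fun fun E => ?_
      rw [Function.comp_apply, amp_parts, h1]
  exact ((Equiv.prodComm _ _).hasSum_iff.2 h2).prod_fiberwise fun L =>
    lp.hasSum_inner (keepSlice χ L y) (P (keepSlice χ L x))

/-- Causality may be checked on the operators `|D⟩⟨E|`. -/
theorem IsCausal.of_ketBra {χ ζ : Selection S K} {U : Op S K}
    (h : ∀ D E, partialTrace ζ (U * ketBra D E * ContinuousLinearMap.adjoint U) =
      partialTrace ζ (U * partialTrace χ (ketBra D E) * ContinuousLinearMap.adjoint U)) :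
    IsCausal χ ζ U := by
  classical
  rintro ρ ⟨x, y, hρ⟩
  replace hρ : NuclearRep x y ρ := hρ
  refine op_ext fun A B => ?_
  -- The observable dual to the `(A, B)` entry: that entry of `(UρU†)_{|ζ}` is `∑ ⟨yᵢ, P xᵢ⟩`, the
  -- trace of `Pρ`.
  let P : Op S K := ContinuousLinearMap.adjoint (dropSlice ζ B ∘L U) ∘L (dropSlice ζ A ∘L U)
  have hPi : ∀ u v, ⟪dropSlice ζ B (U v), dropSlice ζ A (U u)⟫_ℂ = ⟪v, P u⟫_ℂ := fun u v => by
    simp only [P, ContinuousLinearMap.comp_apply, ContinuousLinearMap.adjoint_inner_right]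
  have hk : ∀ D E, entry (partialTrace ζ (U * ketBra D E * ContinuousLinearMap.adjoint U)) A B =
      entry P E D := fun D E => by
    have h0 : NuclearRep (fun _ : Unit => ket D) (fun _ => ket E) (ketBra D E) :=
      ⟨Summable.of_finite, by simp [ketBra]⟩
    have h1 := (h0.conj U).hasSum_entry_partialTrace ζ A B
    rw [entry.eq_1 P, ← hPi]
    exact h1.unique (by simp)
  have hP : ∀ D E, entry P E D = if χ.compl E = χ.compl D then entry P (χ E) (χ D) else 0 := by
    intro D E
    rw [← hk, h, partialTrace_ketBra, partialTraceBasis, mul_smul_comm, smul_mul_assoc,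
      partialTrace_smul, entry_smul, hk, braket_eq, ite_mul, one_mul, zero_mul]
  have h1 := (hρ.conj U).hasSum_entry_partialTrace ζ A B
  have h2 := ((hρ.restrict χ).conj U).hasSum_entry_partialTrace ζ A B
  simp only [hPi] at h1 h2
  exact h1.unique (h2.prod_fiberwise fun i => hasSum_inner_keepSlice χ hP (x i) (y i))

/-! ### Pointwise restrictions -/

/-- `μ` selects the systems that satisfy `m`. -/
def Selection.SelectsBy (μ : Selection S K) (m : S × Vertex K → Prop) : Prop :=
  ∀ G s, s ∈ (μ G).systems ↔ s ∈ G.systems ∧ m s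

/-- Since `{r}_μ ⊆ {r}`, only `s` itself can cause the selection of `s`, whatever the ambient graph.
-/
theorem Selection.IsPointwise.exists_selectsBy {μ : Selection S K} (h : μ.IsPointwise) :
    ∃ m, μ.SelectsBy m := by
  refine ⟨fun s => ∃ G, s ∈ (μ G).systems, fun G s => ⟨fun hs => ⟨μ.subset G hs, G, hs⟩, ?_⟩⟩
  rintro ⟨hs, G', hs'⟩
  obtain ⟨r, hr, hsr⟩ := (h G' s).1 hs'
  obtain rfl : s = r := (QGraph.mem_sub.1 (μ.subset _ hsr)).2
  refine (h G s).2 ⟨s, hs, ?_⟩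
  have : G.sub (· = s) = G'.sub (· = s) := QGraph.ext_mem fun q => by
    simp only [QGraph.mem_sub]
    constructor <;> rintro ⟨_, rfl⟩ <;> simp_all
  rwa [this]

namespace Selection.SelectsBy

variable {μ : Selection S K} {m : S × Vertex K → Prop} (hm : μ.SelectsBy m)
include hm

theorem mem_compl_iff (G : QGraph S K) (s : S × Vertex K) :
    s ∈ (μ.compl G).systems ↔ s ∈ G.systems ∧ ¬ m s := by
  rw [Selection.mem_compl, hm]
  tauto

theorem idem (G : QGraph S K) : μ (μ G) = μ G :=
  QGraph.ext_mem fun s => by simp only [hm _ _]; tauto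

theorem isRestriction_union {χ ζ : Selection S K} (hχ : χ.IsRestriction) (hζ : ζ.IsRestriction) :
    ((μ.andThen χ).union (μ.compl.andThen ζ)).IsRestriction := by
  intro G H hGH hHG
  have h1 : χ (μ H) = χ (μ G) := by
    refine hχ _ _ (fun s hs => ?_) (fun s hs => ?_)
    · exact (hm _ _).2 ⟨hGH (Selection.mem_union.2 (Or.inl hs)), ((hm _ _).1 (χ.subset _ hs)).2⟩
    · exact (hm _ _).2 ⟨hHG ((hm _ _).1 hs).1, ((hm _ _).1 hs).2⟩
  have h2 : ζ (μ.compl H) = ζ (μ.compl G) := by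
    refine hζ _ _ (fun s hs => ?_) (fun s hs => ?_)
    · exact (hm.mem_compl_iff _ _).2 ⟨hGH (Selection.mem_union.2 (Or.inr hs)),
        ((hm.mem_compl_iff _ _).1 (ζ.subset _ hs)).2⟩
    · exact (hm.mem_compl_iff _ _).2 ⟨hHG ((hm.mem_compl_iff _ _).1 hs).1,
        ((hm.mem_compl_iff _ _).1 hs).2⟩
  refine QGraph.ext_mem fun s => ?_
  simp only [Selection.mem_union, Selection.andThen, h1, h2]

theorem mem_union_iff (χ ζ : Selection S K) (G : QGraph S K) (s : S × Vertex K) :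
    s ∈ ((μ.andThen χ).union (μ.compl.andThen ζ) G).systems ↔
      (m s ∧ s ∈ (χ (μ G)).systems) ∨ (¬ m s ∧ s ∈ (ζ (μ.compl G)).systems) := by
  rw [Selection.mem_union]
  refine or_congr ⟨fun h => ⟨?_, h⟩, fun h => h.2⟩ ⟨fun h => ⟨?_, h⟩, fun h => h.2⟩
  · exact ((hm _ _).1 (χ.subset _ h)).2
  · exact ((hm.mem_compl_iff _ _).1 (ζ.subset _ h)).2

theorem apply_union (χ ζ : Selection S K) (G : QGraph S K) :
    μ ((μ.andThen χ).union (μ.compl.andThen ζ) G) = χ (μ G) := by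
  refine QGraph.ext_mem fun s => ?_
  rw [hm, hm.mem_union_iff]
  have := fun h => ((hm G s).1 (χ.subset (μ G) h)).2
  tauto

theorem compl_union (χ ζ : Selection S K) (G : QGraph S K) :
    μ.compl ((μ.andThen χ).union (μ.compl.andThen ζ) G) = ζ (μ.compl G) := by
  refine QGraph.ext_mem fun s => ?_
  rw [hm.mem_compl_iff, hm.mem_union_iff]
  have := fun h => ((hm.mem_compl_iff G s).1 (ζ.subset (μ.compl G) h)).2
  tauto

/-- The complement of `ξ` splits along `μ` into the `χ̄` part of `G_μ` and the `ζ̄` part of `G_μ̄`.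
-/
theorem union_compl_eq_iff (χ ζ : Selection S K) (G H : QGraph S K) :
    ((μ.andThen χ).union (μ.compl.andThen ζ)).compl G =
        ((μ.andThen χ).union (μ.compl.andThen ζ)).compl H ↔
      χ.compl (μ G) = χ.compl (μ H) ∧ ζ.compl (μ.compl G) = ζ.compl (μ.compl H) := by
  have h1 : ∀ G, μ (((μ.andThen χ).union (μ.compl.andThen ζ)).compl G) = χ.compl (μ G) :=
    fun G => QGraph.ext_mem fun s => by
      rw [hm, Selection.mem_compl, Selection.mem_compl, hm.mem_union_iff, hm]
      tauto
  have h2 : ∀ G, μ.compl (((μ.andThen χ).union (μ.compl.andThen ζ)).compl G) =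
      ζ.compl (μ.compl G) :=
    fun G => QGraph.ext_mem fun s => by
      rw [hm.mem_compl_iff, Selection.mem_compl, Selection.mem_compl, hm.mem_union_iff,
        hm.mem_compl_iff]
      tauto
  rw [← h1, ← h1, ← h2, ← h2]
  exact ⟨fun h => by rw [h]; exact ⟨rfl, rfl⟩, fun h => Selection.eq_of_parts h.1 h.2⟩

end Selection.SelectsBy

theorem Selection.IsRestriction.idem {ζ : Selection S K} (h : ζ.IsRestriction) (G : QGraph S K) :
    ζ (ζ G) = ζ G := h G (ζ G) (fun _ h => h) (ζ.subset G)

/-- Both sides are the empty graph, by idempotence. -/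
theorem Selection.IsRestriction.compl_apply_eq {ζ : Selection S K} (h : ζ.IsRestriction)
    (G H : QGraph S K) : ζ.compl (ζ G) = ζ.compl (ζ H) :=
  QGraph.ext_mem fun s => by simp [Selection.mem_compl, h.idem]

/-! ### Names -/

theorem Name.proj_join_l {X : Type*} (u v : Name X) : (u.join v).proj .l = u :=
  Quotient.inductionOn₂ u v fun a b => Quotient.sound (NameTerm.Eqv.join_l a b)

theorem Name.proj_join_r {X : Type*} (u v : Name X) : (u.join v).proj .r = v :=
  Quotient.inductionOn₂ u v fun a b => Quotient.sound (NameTerm.Eqv.join_r a b)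

theorem Name.dot_append {X : Type*} (u : Name X) (t t' : List Dir) :
    u.dot (t ++ t') = (u.dot t).dot t' := List.foldl_append

/-- A name generated by `V` lies, after a long enough word, below a name of `V`. -/
theorem Name.Generated.exists_dot_eq {X : Type*} {V : Set (Name X)} {u : Name X}
    (h : Name.Generated V u) :
    ∃ n, ∀ t : List Dir, n ≤ t.length → ∃ v ∈ V, ∃ t', u.dot t = v.dot t' := by
  induction h with
  | base hu => exact ⟨0, fun t _ => ⟨_, hu, t, rfl⟩⟩
  | proj d _ ih =>
    obtain ⟨n, hn⟩ := ih
    exact ⟨n, fun t ht => hn (d :: t) (by simp; omega)⟩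
  | @join u v _ _ ihu ihv =>
    obtain ⟨n, hn⟩ := ihu
    obtain ⟨k, hk⟩ := ihv
    refine ⟨n + k + 1, fun t ht => ?_⟩
    cases t with
    | nil => simp at ht
    | cons d t =>
      simp only [List.length_cons] at ht
      cases d with
      | l =>
        obtain ⟨w, hw, t', h⟩ := hn t (by omega)
        refine ⟨w, hw, t', h ▸ ?_⟩
        change ((u.join v).proj .l).dot t = u.dot t
        rw [Name.proj_join_l]
      | r =>
        obtain ⟨w, hw, t', h⟩ := hk t (by omega)
        refine ⟨w, hw, t', h ▸ ?_⟩
        change ((u.join v).proj .r).dot t = v.dot t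
        rw [Name.proj_join_r]

/-- In a graph, the `μ` part may be replaced by a graph with the same names. -/
theorem Selection.SelectsBy.exists_replace {μ : Selection S K} {m : S × Vertex K → Prop}
    (hm : μ.SelectsBy m) {A D : QGraph S K} (hA : μ A = A)
    (hAD : SameNames (μ D).support A.support) : ∃ G, μ G = A ∧ μ.compl G = μ.compl D := by
  classical
  have hAm : ∀ s ∈ A.systems, m s := fun s hs => by
    rw [← hA] at hs
    exact ((hm _ _).1 hs).2
  have hcross : ∀ a ∈ A.systems, ∀ b ∈ (μ.compl D).systems, ∀ t t' : List Dir,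
      a.2.dot t ≠ b.2.dot t' := by
    intro a ha b hb t t' htt
    have hgen : Name.Generated (μ D).support a.2 := (hAD _).2 (.base ⟨a.1, ha⟩)
    obtain ⟨n, hn⟩ := hgen.exists_dot_eq
    -- Padding by `n` letters makes the word long enough to land below a name of `D_μ`;
    -- well-namedness of `D` then puts `b` in `D_μ`, a contradiction.
    obtain ⟨v, ⟨σ, hv⟩, r, hr⟩ := hn (t ++ List.replicate n .l) (by simp)
    rw [Name.dot_append, htt, ← Name.dot_append] at hr
    have h1 := (hm _ _).1 hv
    have h2 := (hm.mem_compl_iff _ _).1 hb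
    have h3 := (D.wellNamed b h2.1 (σ, v) h1.1 _ _ hr).1
    exact h2.2 (h3 ▸ h1.2)
  refine ⟨⟨A.systems ∪ (μ.compl D).systems, ?_⟩, ?_, ?_⟩
  · intro s hs s' hs' t t' h
    rw [Finset.mem_union] at hs hs'
    rcases hs with hs | hs <;> rcases hs' with hs' | hs'
    · exact A.wellNamed s hs s' hs' t t' h
    · exact absurd h (hcross s hs s' hs' t t')
    · exact absurd h.symm (hcross s' hs' s hs t' t)
    · exact (μ.compl D).wellNamed s hs s' hs' t t' h
  · refine QGraph.ext_mem fun s => ?_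
    rw [hm, Finset.mem_union, hm.mem_compl_iff]
    have := hAm s
    tauto
  · refine QGraph.ext_mem fun s => ?_
    rw [hm.mem_compl_iff, Finset.mem_union, hm.mem_compl_iff]
    have := hAm s
    tauto

/-! ### Operators over `ℋ_μ` -/

theorem ket_mem_subHilb (μ : Selection S K) (G : QGraph S K) : ket (μ G) ∈ subHilb μ :=
  Submodule.le_topologicalClosure _ (Submodule.subset_span ⟨G, rfl⟩)

theorem apply_eq_zero_of_mem_subHilb {μ : Selection S K} {x : Hilb S K} (hx : x ∈ subHilb μ)
    {C : QGraph S K} (hC : ∀ G, μ G ≠ C) : x C = 0 := by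
  have h : subHilb μ ≤ LinearMap.ker (innerSL ℂ (ket C)).toLinearMap := by
    refine Submodule.topologicalClosure_minimal _ (Submodule.span_le.2 ?_)
      (innerSL ℂ (ket C)).isClosed_ker
    rintro _ ⟨G, rfl⟩
    classical
    simp [inner_ket_left, ket_apply, (hC G).symm]
  simpa [inner_ket_left] using h hx

theorem extendByZero_apply_coe (μ : Selection S K) (U : subHilb μ →L[ℂ] subHilb μ)
    (x : subHilb μ) : extendByZero μ U (x : Hilb S K) = U x := by
  simp [extendByZero]

theorem extendByZero_apply_mem (μ : Selection S K) (U : subHilb μ →L[ℂ] subHilb μ)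
    (x : Hilb S K) : extendByZero μ U x ∈ subHilb μ := Subtype.mem _

theorem adjoint_extendByZero (μ : Selection S K) (U : subHilb μ →L[ℂ] subHilb μ) :
    ContinuousLinearMap.adjoint (extendByZero μ U) =
      extendByZero μ (ContinuousLinearMap.adjoint U) := by
  simp only [extendByZero, ContinuousLinearMap.adjoint_comp, Submodule.adjoint_subtypeL,
    Submodule.adjoint_orthogonalProjectionOnto, ContinuousLinearMap.comp_assoc]

theorem extendByZero_rankOne (μ : Selection S K) (x y : subHilb μ) :
    extendByZero μ (InnerProductSpace.rankOne ℂ x y) =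
      InnerProductSpace.rankOne ℂ (x : Hilb S K) (y : Hilb S K) := by
  ext1 z
  simp [extendByZero]

theorem inner_extendByZero (μ : Selection S K) {U : subHilb μ →L[ℂ] subHilb μ}
    (hU : ContinuousLinearMap.adjoint U * U = 1) (D E : QGraph S K) :
    ⟪extendByZero μ U (ket (μ D)), extendByZero μ U (ket (μ E))⟫_ℂ =
      ⟪ket (μ D), ket (μ E)⟫_ℂ := by
  have h := fun G => extendByZero_apply_coe μ U ⟨ket (μ G), ket_mem_subHilb μ G⟩
  simp only at h
  rw [h, h, ← Submodule.coe_inner, ← ContinuousLinearMap.adjoint_inner_right,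
    ← mul_apply_eq_comp, hU, one_apply_eq_self, Submodule.coe_inner]

theorem IsNamePreserving.adjoint {A : Op S K} (h : IsNamePreserving A) :
    IsNamePreserving (ContinuousLinearMap.adjoint A) := fun G H hGH => by
  rw [entry_adjoint, h H G fun h => hGH fun u => (h u).symm, star_zero]

/-- The image lies in `ℋ_μ`, so `A_μ = A`; name preservation then allows the replacement in `D`. -/
theorem Selection.SelectsBy.exists_of_entry_ne_zero {μ : Selection S K} {m : S × Vertex K → Prop}
    (hm : μ.SelectsBy m) {U : subHilb μ →L[ℂ] subHilb μ}
    (hU : IsNamePreserving (extendByZero μ U)) {A D : QGraph S K}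
    (h : entry (extendByZero μ U) A (μ D) ≠ 0) : ∃ G, μ G = A ∧ μ.compl G = μ.compl D := by
  refine hm.exists_replace ?_ ?_
  · by_contra hA
    refine h ?_
    rw [entry_eq_apply]
    refine apply_eq_zero_of_mem_subHilb (extendByZero_apply_mem μ U _) fun G hG => hA ?_
    rw [← hG, hm.idem]
  · by_contra hs
    exact h (hU _ _ hs)

/-! ### The operator `A ⊗_μ I` -/

open scoped Classical in
theorem adjoint_keepSlice_apply (μ : Selection S K) (L : QGraph S K) (z : Hilb S K)
    (C : QGraph S K) : ContinuousLinearMap.adjoint (keepSlice μ L) z C =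
      if μ.compl C = L then z (μ C) else 0 := by
  rw [← inner_ket_left, ContinuousLinearMap.adjoint_inner_right, keepSlice_ket]
  split_ifs
  · rw [inner_ket_left]
  · rw [inner_zero_left]

theorem keepSlice_adjoint_keepSlice (μ : Selection S K) (L : QGraph S K) {z : Hilb S K}
    (hz : ∀ A, z A ≠ 0 → ∃ G, μ G = A ∧ μ.compl G = L) :
    keepSlice μ L (ContinuousLinearMap.adjoint (keepSlice μ L) z) = z := by
  ext A
  rw [keepSlice_apply]
  by_cases h : ∃ G, μ G = A ∧ μ.compl G = L
  · obtain ⟨G, rfl, rfl⟩ := h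
    rw [amp_parts, adjoint_keepSlice_apply, if_pos rfl]
  · rw [amp_eq_zero _ h]
    by_contra hc
    exact h (hz A (Ne.symm hc))

open scoped Classical in
-- Column `D` is `V|D_μ⟩` glued to `D_μ̄`. By `hV'` the gluing loses no coordinate, so columns with
-- equal complements keep their inner product; the others have disjoint supports.
theorem exists_isometry_entry (μ : Selection S K) {V : Op S K}
    (hV : ∀ D E, ⟪V (ket (μ D)), V (ket (μ E))⟫_ℂ = ⟪ket (μ D), ket (μ E)⟫_ℂ)
    (hV' : ∀ A D, entry V A (μ D) ≠ 0 → ∃ G, μ G = A ∧ μ.compl G = μ.compl D) :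
    ∃ W : Op S K, ContinuousLinearMap.adjoint W * W = 1 ∧ ∀ C D, entry W C D =
      if μ.compl C = μ.compl D then entry V (μ C) (μ D) else 0 := by
  let v : QGraph S K → Hilb S K := fun D =>
    ContinuousLinearMap.adjoint (keepSlice μ (μ.compl D)) (V (ket (μ D)))
  have hv : ∀ D C, v D C = if μ.compl C = μ.compl D then entry V (μ C) (μ D) else 0 :=
    fun D C => by rw [adjoint_keepSlice_apply, entry_eq_apply]
  have hon : Orthonormal ℂ v := by
    rw [orthonormal_iff_ite]
    intro D E
    by_cases h : μ.compl D = μ.compl E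
    · have h1 : ⟪v D, v E⟫_ℂ = ⟪ket (μ D), ket (μ E)⟫_ℂ := by
        simp only [v]
        rw [ContinuousLinearMap.adjoint_inner_left, h, keepSlice_adjoint_keepSlice, hV]
        intro A hA
        rw [← entry_eq_apply] at hA
        exact hV' A E hA
      rw [h1, inner_ket_left, ket_apply]
      exact if_congr ⟨fun h2 => Selection.eq_of_parts h2 h, fun h2 => h2 ▸ rfl⟩ rfl rfl
    · rw [if_neg (fun h2 : D = E => h (h2 ▸ rfl)), lp.inner_eq_tsum]
      refine (tsum_congr fun C => ?_).trans tsum_zero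
      rw [hv, hv]
      by_cases h1 : μ.compl C = μ.compl D
      · rw [if_neg (fun h2 => h (h1.symm.trans h2)), inner_zero_right]
      · rw [if_neg h1, inner_zero_left]
  let W := hon.orthogonalFamily.linearIsometry
  have hW : ∀ D, W (ket D) = v D := fun D => by
    simp only [W, ket]
    rw [OrthogonalFamily.linearIsometry_apply_single]
    simp
  refine ⟨W.toContinuousLinearMap, ?_, fun C D => ?_⟩
  · exact (ContinuousLinearMap.norm_map_iff_adjoint_comp_self _).1 W.norm_map
  · rw [entry_eq_apply, LinearIsometry.coe_toContinuousLinearMap, hW, hv]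

open scoped Classical in
theorem inner_ket_tensorKet (μ : Selection S K) (C A L : QGraph S K) :
    ⟪ket C, tensorKet μ A L⟫_ℂ = if μ C = A ∧ μ.compl C = L then 1 else 0 := by
  by_cases h : ∃ G, μ G = A ∧ μ.compl G = L
  · obtain ⟨G, rfl, rfl⟩ := h
    rw [tensorKet_parts, inner_ket_left, ket_apply]
    exact if_congr ⟨fun h => h ▸ ⟨rfl, rfl⟩, fun h => Selection.eq_of_parts h.1 h.2⟩ rfl rfl
  · rw [tensorKet_eq_zero h, inner_zero_right, if_neg fun h' => h ⟨C, h'⟩]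

open scoped Classical in
-- Only the index formed by the parts of `C` and `D` contributes.
theorem isTensor_one_iff (μ : Selection S K) (A T : Op S K) :
    IsTensor μ A 1 T ↔ ∀ C D, entry T C D =
      if μ.compl C = μ.compl D then entry A (μ C) (μ D) else 0 := by
  refine forall₂_congr fun C D => ?_
  have h : HasSum (fun q : (QGraph S K × QGraph S K) × (QGraph S K × QGraph S K) =>
      entry A q.1.1 q.1.2 * entry 1 q.2.1 q.2.2 *
        (⟪ket C, tensorKet μ q.1.1 q.2.1⟫_ℂ * ⟪tensorKet μ q.1.2 q.2.2, ket D⟫_ℂ))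
      (if μ.compl C = μ.compl D then entry A (μ C) (μ D) else 0) := by
    convert hasSum_single ((μ C, μ D), (μ.compl C, μ.compl D)) ?_ using 1
    · rw [entry_eq_apply 1, one_apply_eq_self, ket_apply, tensorKet_parts, tensorKet_parts,
        inner_ket_left, inner_ket_left, ket_apply, ket_apply]
      simp
    · intro q hq
      rw [← inner_conj_symm _ (ket D), inner_ket_tensorKet, inner_ket_tensorKet]
      by_cases h1 : μ C = q.1.1 ∧ μ.compl C = q.2.1
      · by_cases h2 : μ D = q.1.2 ∧ μ.compl D = q.2.2
        · exact absurd (Prod.ext (Prod.ext h1.1.symm h2.1.symm) (Prod.ext h1.2.symm h2.2.symm)) hq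
        · simp [h2]
      · simp [h1]
  exact ⟨fun h' => h'.unique h, fun h' => h' ▸ h⟩

theorem Selection.SelectsBy.exists_unitary_isTensor {μ : Selection S K} {m : S × Vertex K → Prop}
    (hm : μ.SelectsBy m) {U : subHilb μ →L[ℂ] subHilb μ}
    (hU : U ∈ unitary (subHilb μ →L[ℂ] subHilb μ)) (hn : IsNamePreserving (extendByZero μ U)) :
    ∃ W ∈ unitary (Op S K), IsTensor μ (extendByZero μ U) 1 W := by
  classical
  have hn' := hn.adjoint
  rw [adjoint_extendByZero] at hn'
  obtain ⟨W, hW, hWe⟩ := exists_isometry_entry μ (V := extendByZero μ U)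
    (inner_extendByZero μ hU.1) fun _ _ => hm.exists_of_entry_ne_zero hn
  obtain ⟨W', hW', hWe'⟩ := exists_isometry_entry μ
    (V := extendByZero μ (ContinuousLinearMap.adjoint U))
    (inner_extendByZero μ (by rw [ContinuousLinearMap.adjoint_adjoint]; exact hU.2))
    fun _ _ => hm.exists_of_entry_ne_zero hn'
  have hadj : W' = ContinuousLinearMap.adjoint W := op_ext fun C D => by
    rw [hWe', entry_adjoint, hWe, ← adjoint_extendByZero, entry_adjoint]
    by_cases h : μ.compl C = μ.compl D
    · rw [if_pos h, if_pos h.symm]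
    · rw [if_neg h, if_neg (Ne.symm h), star_zero]
  rw [hadj, ContinuousLinearMap.adjoint_adjoint] at hW'
  exact ⟨W, ⟨hW, hW'⟩, (isTensor_one_iff _ _ _).2 hWe⟩

/-! ### Causality of `U ⊗_μ I` -/

theorem entry_conj_ketBra (T : Op S K) (D E G H : QGraph S K) :
    entry (T * ketBra D E * ContinuousLinearMap.adjoint T) G H =
      entry T G D * star (entry T H E) := by
  have : T * ketBra D E * ContinuousLinearMap.adjoint T =
      InnerProductSpace.rankOne ℂ (T (ket D)) (T (ket E)) := by
    ext1 z
    simp [ketBra, ContinuousLinearMap.adjoint_inner_right]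
  rw [this, entry_rankOne, entry_eq_apply, entry_eq_apply]

theorem isTraceClass_ketBra (D E : QGraph S K) : IsTraceClass (ketBra D E) :=
  isTraceClass_rankOne _ _

section Commuting

variable {μ ζ : Selection S K}

theorem Selection.apply_eq_iff (h1 : μ.Commutes ζ) (h2 : μ.compl.Commutes ζ) (G A : QGraph S K) :
    ζ G = A ↔ ζ (μ G) = μ A ∧ ζ (μ.compl G) = μ.compl A := by
  have h1' : ζ (μ G) = μ (ζ G) := h1 G
  have h2' : ζ (μ.compl G) = μ.compl (ζ G) := h2 G
  rw [h1', h2']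
  exact ⟨fun h => h ▸ ⟨rfl, rfl⟩, fun h => Selection.eq_of_parts h.1 h.2⟩

theorem Selection.compl_apply_eq_iff (h3 : μ.Commutes ζ.compl) (h4 : μ.compl.Commutes ζ.compl)
    (G H : QGraph S K) : ζ.compl G = ζ.compl H ↔
      ζ.compl (μ G) = ζ.compl (μ H) ∧ ζ.compl (μ.compl G) = ζ.compl (μ.compl H) := by
  rw [Selection.apply_eq_iff h3 h4, show ζ.compl (μ H) = μ (ζ.compl H) from h3 H,
    show ζ.compl (μ.compl H) = μ.compl (ζ.compl H) from h4 H]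

open scoped Classical in
/-- Tracing out `ζ̄` after `A ⊗_μ I` amounts to tracing it out after `A` on the `μ` part. -/
theorem entry_partialTrace_tensor (h1 : μ.Commutes ζ) (h2 : μ.compl.Commutes ζ)
    (h3 : μ.Commutes ζ.compl) (h4 : μ.compl.Commutes ζ.compl) {V T : Op S K}
    (hV : ∀ A D, entry V A (μ D) ≠ 0 → ∃ G, μ G = A ∧ μ.compl G = μ.compl D)
    (hT : ∀ C D, entry T C D = if μ.compl C = μ.compl D then entry V (μ C) (μ D) else 0)
    (D E A B : QGraph S K) :
    entry (partialTrace ζ (T * ketBra D E * ContinuousLinearMap.adjoint T)) A B =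
      if ζ.compl (μ.compl E) = ζ.compl (μ.compl D) ∧ ζ (μ.compl D) = μ.compl A ∧
          ζ (μ.compl E) = μ.compl B then
        entry (partialTrace ζ (V * ketBra (μ D) (μ E) * ContinuousLinearMap.adjoint V)) (μ A) (μ B)
      else 0 := by
  have hf := hasSum_entry_partialTrace ζ ((isTraceClass_ketBra D E).conj T) A B
  have hg := hasSum_entry_partialTrace ζ ((isTraceClass_ketBra (μ D) (μ E)).conj V) (μ A) (μ B)
  simp only [entry_conj_ketBra] at hf hg
  have hiff : ∀ p : QGraph S K × QGraph S K, μ.compl p.1 = μ.compl D → μ.compl p.2 = μ.compl E →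
      ((ζ.compl p.2 = ζ.compl p.1 ∧ ζ p.1 = A ∧ ζ p.2 = B) ↔
        (ζ.compl (μ p.2) = ζ.compl (μ p.1) ∧ ζ (μ p.1) = μ A ∧ ζ (μ p.2) = μ B) ∧
        (ζ.compl (μ.compl E) = ζ.compl (μ.compl D) ∧ ζ (μ.compl D) = μ.compl A ∧
          ζ (μ.compl E) = μ.compl B)) := fun p hp1 hp2 => by
    rw [Selection.compl_apply_eq_iff h3 h4, Selection.apply_eq_iff h1 h2,
      Selection.apply_eq_iff h1 h2 p.2, hp1, hp2]
    tauto
  have hTne : ∀ {C D}, entry T C D ≠ 0 → μ.compl C = μ.compl D := fun {C D} h => by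
    rw [hT] at h
    by_contra hc
    exact h (if_neg hc)
  split_ifs with hc
  · have heq : ∀ p : QGraph S K × QGraph S K, μ.compl p.1 = μ.compl D → μ.compl p.2 = μ.compl E →
        entry V (μ p.1) (μ D) * star (entry V (μ p.2) (μ E)) *
          (if ζ.compl (μ p.2) = ζ.compl (μ p.1) ∧ ζ (μ p.1) = μ A ∧ ζ (μ p.2) = μ B
            then 1 else 0) =
        entry T p.1 D * star (entry T p.2 E) *
          if ζ.compl p.2 = ζ.compl p.1 ∧ ζ p.1 = A ∧ ζ p.2 = B then 1 else 0 :=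
      fun p hp1 hp2 => by
        rw [hT, hT, if_pos hp1, if_pos hp2]
        congr 1
        exact if_congr (((hiff p hp1 hp2).trans (and_iff_left hc)).symm) rfl rfl
    have hsupp : ∀ p : QGraph S K × QGraph S K, entry T p.1 D * star (entry T p.2 E) *
        (if ζ.compl p.2 = ζ.compl p.1 ∧ ζ p.1 = A ∧ ζ p.2 = B then 1 else 0) ≠ 0 →
        μ.compl p.1 = μ.compl D ∧ μ.compl p.2 = μ.compl E := fun p hp => by
      have hp' := left_ne_zero_of_mul hp
      exact ⟨hTne (left_ne_zero_of_mul hp'), hTne (star_ne_zero.1 (right_ne_zero_of_mul hp'))⟩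
    -- Reindexing by `μ` parts: injective on the support because the `μ̄` parts are those of `D` and
    -- `E`, and onto the support of the `V` series by `hV`.
    refine hf.unique ((hasSum_iff_hasSum_of_ne_zero_bij
      (fun p => (μ p.1.1, μ p.1.2)) ?_ ?_ ?_).1 hg)
    · rintro ⟨p, hp⟩ ⟨q, hq⟩ hpq
      simp only [Prod.mk.injEq] at hpq
      have hp' := hsupp p hp
      have hq' := hsupp q hq
      exact Subtype.ext (Prod.ext (Selection.eq_of_parts hpq.1 (hp'.1.trans hq'.1.symm))
        (Selection.eq_of_parts hpq.2 (hp'.2.trans hq'.2.symm)))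
    · rintro ⟨A', B'⟩ hq
      rw [Function.mem_support] at hq
      have hq' := left_ne_zero_of_mul hq
      obtain ⟨G, rfl, hG⟩ := hV _ _ (left_ne_zero_of_mul hq')
      obtain ⟨H, rfl, hH⟩ := hV _ _ (star_ne_zero.1 (right_ne_zero_of_mul hq'))
      refine ⟨⟨(G, H), ?_⟩, rfl⟩
      rw [Function.mem_support, ← heq (G, H) hG hH]
      exact hq
    · rintro ⟨p, hp⟩
      exact heq p (hsupp p hp).1 (hsupp p hp).2
  · refine hf.unique ?_
    convert hasSum_zero with p
    by_contra hp
    simp only [mul_eq_zero, not_or, star_eq_zero, ite_eq_right_iff, one_ne_zero, imp_false,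
      not_not] at hp
    exact hc ((hiff p (hTne hp.1.1) (hTne hp.1.2)).1 hp.2).2

end Commuting

/-- After tracing out `ξ̄`, the `ζ̄` condition on the `μ̄` parts becomes trivial, but it reappears
in the bracket of the `ξ̄` parts; the `χ̄` bracket is the one produced by causality of `U`. -/
theorem IsCausalOver.tensor_one {μ χ ζ : Selection S K} {m : S × Vertex K → Prop}
    (hm : μ.SelectsBy m) (hζ : ζ.IsRestriction) (h1 : μ.Commutes ζ) (h2 : μ.compl.Commutes ζ)
    (h3 : μ.Commutes ζ.compl) (h4 : μ.compl.Commutes ζ.compl) {U : subHilb μ →L[ℂ] subHilb μ}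
    (hn : IsNamePreserving (extendByZero μ U)) (hU : IsCausalOver μ χ ζ U) {T : Op S K}
    (hT : IsTensor μ (extendByZero μ U) 1 T) :
    IsCausal ((μ.andThen χ).union (μ.compl.andThen ζ)) ζ T := by
  classical
  refine IsCausal.of_ketBra fun D E => op_ext fun A B => ?_
  have hform := entry_partialTrace_tensor h1 h2 h3 h4
    (fun _ _ => hm.exists_of_entry_ne_zero hn) ((isTensor_one_iff _ _ _).1 hT)
  have hcausal := hU (InnerProductSpace.rankOne ℂ ⟨ket (μ D), ket_mem_subHilb μ D⟩
    ⟨ket (μ E), ket_mem_subHilb μ E⟩) (isTraceClass_rankOne _ _)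
  rw [extendByZero_rankOne] at hcausal
  change partialTrace ζ (_ * ketBra (μ D) (μ E) * _) =
    partialTrace ζ (_ * partialTrace χ (ketBra (μ D) (μ E)) * _) at hcausal
  rw [partialTrace_ketBra, partialTraceBasis, mul_smul_comm, smul_mul_assoc,
    partialTrace_smul] at hcausal ⊢
  rw [entry_smul, hform, hform, hcausal, entry_smul, hm.apply_union, hm.apply_union,
    hm.compl_union, hm.compl_union, hζ.idem, hζ.idem, braket_eq, braket_eq]
  have hξ := hm.union_compl_eq_iff χ ζ E D
  have hc := hζ.compl_apply_eq (μ.compl E) (μ.compl D)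
  simp only [hξ, hc, true_and]
  by_cases ha : ζ.compl (μ.compl E) = ζ.compl (μ.compl D) <;>
    by_cases hb : χ.compl (μ E) = χ.compl (μ D) <;> simp [ha, hb]

end QNet


theorem mainTheorem10 (S K : Type*) [Countable K] :
    (∀ χ' ζ' χ ζ : QNet.Selection S K,
      χ'.IsRestriction → ζ'.IsRestriction → χ.IsRestriction → ζ.IsRestriction →
      QNet.Comprehended χ' χ → QNet.Comprehended ζ ζ' →
      ∀ U : QNet.Op S K, QNet.IsCausal χ' ζ' U → QNet.IsCausal χ ζ U) ∧
    (∀ μ χ ζ : QNet.Selection S K,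
      μ.IsRestriction → χ.IsRestriction → ζ.IsRestriction → μ.IsPointwise →
      μ.Commutes ζ → μ.compl.Commutes ζ → μ.Commutes ζ.compl → μ.compl.Commutes ζ.compl →
      ∀ U : QNet.subHilb μ →L[ℂ] QNet.subHilb μ,
        U ∈ unitary (QNet.subHilb μ →L[ℂ] QNet.subHilb μ) →
        QNet.IsNamePreserving (QNet.extendByZero μ U) →
        QNet.IsCausalOver μ χ ζ U →
        ((μ.andThen χ).union (μ.compl.andThen ζ)).IsRestriction ∧
        (∃! U' : QNet.Op S K, QNet.IsTensor μ (QNet.extendByZero μ U) 1 U') ∧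
        ∀ U' : QNet.Op S K, QNet.IsTensor μ (QNet.extendByZero μ U) 1 U' →
          U' ∈ unitary (QNet.Op S K) ∧
          QNet.IsCausal ((μ.andThen χ).union (μ.compl.andThen ζ)) ζ U') := by
  refine ⟨fun χ' ζ' χ ζ _ _ _ _ hχ hζ U hU => hU.of_comprehended hχ hζ, ?_⟩
  intro μ χ ζ _ hχ hζ hμ h1 h2 h3 h4 U hU hn hc
  obtain ⟨m, hm⟩ := hμ.exists_selectsBy
  obtain ⟨W, hW, hWT⟩ := hm.exists_unitary_isTensor hU hn
  have huniq : ∀ T, QNet.IsTensor μ (QNet.extendByZero μ U) 1 T → T = W := fun T hT =>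
    QNet.op_ext fun C D => (hT C D).unique (hWT C D)
  refine ⟨hm.isRestriction_union hχ hζ, ⟨W, hWT, huniq⟩, fun T hT => ⟨?_, ?_⟩⟩
  · rw [huniq T hT]
    exact hW
  · exact hc.tensor_one hm hζ h1 h2 h3 h4 hn hT
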